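/- Let $X$ be a set with at least two elements; maps are composed from left to right. Let $Sing(X)$ be the set of non-bijective maps $X\to X$, and for $a\colon X\to X$ let $\pi_a$ be the partition of $X$ into the fibres of $a$. The powerset category $\mathscr P(X)$ has as objects the non-empty proper subsets of $X$ and as morphisms all functions between them; its inclusions are the inclusion maps. The category of partitions $\Pi(X)$ has one object $\bar\pi$, the set of all functions $\pi\to X$, for each partition $\pi$ of $X$ other than the partition into singletons; its morphisms $\bar\pi_1\to\bar\pi_2$ are the maps $\eta^*\colon\alpha\mapsto\eta\alpha$ with $\eta\colon\pi_2\to\pi_1$ a function; $\bar\pi_1\subseteq\bar\pi_2$ means that $\pi_2$ refines $\pi_1$, and the inclusion is $\nu^*$, where $\nu$ sends a block of $\pi_2$ to the block of $\pi_1$ containing it. For a normal category $\mathcal C$, a normal cone $\gamma$ with vertex $c_\gamma$ is a family of morphisms $\gamma(c)\colon c\to c_\gamma$ compatible with inclusions, at least one of which is an isomorphism; $\gamma*f$ is the cone $c\mapsto\gamma(c)f$; $f^\circ$ is the epimorphic component of $f$; $H(\gamma;-)$ is the functor $\mathcal C\to\mathbf{Set}$ with $H(\gamma;c)=\{\gamma*f^\circ: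 f\colon c_\gamma\to c\}$ and $H(\gamma;g)\colon\gamma*f^\circ\mapsto\gamma*(fg)^\circ$; and $M\gamma=MH(\gamma;-)$ is the set of objects $c$ with $\gamma(c)$ invertible. The normal dual $N^*\mathcal C$ is the category of the functors $H(\varepsilon;-)$, $\varepsilon$ an idempotent normal cone (for the product $\gamma\cdot\sigma=\gamma*(\sigma(c_\gamma))^\circ$), and all natural transformations between them; its subobjects are subfunctors. A cross-connection from $\mathcal D$ to $\mathcal C$ is a local isomorphism $\Gamma\colon\mathcal D\to N^*\mathcal C$ (an inclusion-preserving fully faithful functor that maps the full subcategory of the subobjects of each object $d$ isomorphically onto that of $\Gamma(d)$) such that every object $c$ of $\mathcal C$ lies in $M\Gamma(d)$ for some $d$. Its bifunctor is $\Gamma(c,d)=\Gamma(d)(c)$ on $\mathcal C\times\mathcal D$; for a cross-connection $\Delta\colon\mathcal C\to N^*\mathcal D$ one puts $\Delta(c,d)=\Delta(c)(d)$. Such a $\Delta$ is dual to $\Gamma$, with associated duality $\chi$, if $c\in M\Gamma(d)\Leftrightarrow d\in M\Delta(c)$ for all $c,d$, and $\chi\colon\Gamma(-,-)\to\Delta(-,-)$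 is a natural isomorphism that sends the idempotent cone with vertex $c$ generating $\Gamma(d)$ to the idempotent cone with vertex $d$ generating $\Delta(c)$ whenever $c\in M\Gamma(d)$. Each non-injective $a\in Sing(X)$ with $\mathrm{Im}\,a\ne X$ defines a normal cone $\rho^a$ in $\mathscr P(X)$, with vertex $\mathrm{Im}\,a$ and components the restrictions of $a$, and a cone $\sigma^a$ in $\Pi(X)$, with vertex $\bar\pi_a$ and with component at $\bar\alpha$ equal to $\eta^*$, where $\eta$ sends the block of $x$ in $\pi_a$ to the block of $(x)a$ in $\alpha$. The categories $\Pi(X)$ and $\mathscr P(X)$ are mapped to $N^*\mathscr P(X)$ and $N^*\Pi(X)$ by $\bar\pi\mapsto H(\rho^e;-)$ with $e$ idempotent, $\pi_e=\pi$, and $A\mapsto H(\sigma^e;-)$ with $e$ idempotent, $\mathrm{Im}\,e=A$; on morphisms, $\eta^*$ gives $\rho^a\mapsto\rho^{\eta a}$ and $f$ gives $\sigma^a\mapsto\sigma^{af}$. **Proposition.** Let $\theta$ be a permutation of $X$. Let $\Gamma_\theta\colon\Pi(X)\to\Pi(X)$ be the functor $\bar\pi\mapsto\overline{\theta^{-1}(\pi)}$,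 $\eta^*\mapsto(\theta\eta\theta^{-1})^*$, and let $\Delta_\theta\colon\mathscr P(X)\to\mathscr P(X)$ be the functor $A\mapsto\theta(A)$, $f\mapsto\theta^{-1}f\theta$. Consider the bifunctors $\mathscr P(X)\times\Pi(X)\to\mathbf{Set}$ $$\Gamma_\theta(A,\bar\pi)=\{a\in Sing(X):\mathrm{Im}\,a\subseteq A,\ \bar\pi_a\subseteq\Gamma_\theta(\bar\pi)\},\qquad \Gamma_\theta(f,v^*)\colon a\mapsto uaf,\quad u^*=\Gamma_\theta(v^*),$$ $$\Delta_\theta(A,\bar\pi)=\{a\in Sing(X):\mathrm{Im}\,a\subseteq\Delta_\theta(A),\ \bar\pi_a\subseteq\bar\pi\},\qquad \Delta_\theta(f,v^*)\colon a\mapsto vag,\quad g=\Delta_\theta(f).$$ Then $\chi(A,\bar\pi)\colon a\mapsto\theta^{-1}a\theta$ defines a natural isomorphism $\chi\colon\Gamma_\theta(-,-)\to\Delta_\theta(-,-)$. Moreover, regarding $\Gamma_\theta$ and $\Delta_\theta$ as functors $\Pi(X)\to N^*\mathscr P(X)$ and $\mathscr P(X)\to N^*\Pi(X)$ by the maps above,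 and identifying the elements $a$ of $\Gamma_\theta(A,\bar\pi)$ with $\rho^a$ and those of $\Delta_\theta(A,\bar\pi)$ with $\sigma^a$, both are cross-connections, $\Delta_\theta$ is the unique dual cross-connection of $\Gamma_\theta$, and $\chi$ is the unique associated duality. -/

import Mathlib

open CategoryTheory

universe u

namespace CrossConn

/-! ### Categories with subobjects -/

/-- A small category with a choice of subobjects: a partial order `Sub` on the objects together
with a coherent choice of one morphism (the inclusion `j(c,d)`) for each related pair `c ⊆ d`; the
inclusions form a subcategory of monomorphisms, and `h j = j'` with `j, j'` inclusions forces `h`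
to be an inclusion. -/
class SubobjectCategory (C : Type u) [SmallCategory C] where
  Sub : C → C → Prop
  sub_refl : ∀ c, Sub c c
  sub_trans : ∀ {b c d}, Sub b c → Sub c d → Sub b d
  sub_antisymm : ∀ {c d}, Sub c d → Sub d c → c = d
  incl : ∀ {c d : C}, Sub c d → (c ⟶ d)
  incl_refl : ∀ c, incl (sub_refl c) = 𝟙 c
  incl_comp : ∀ {b c d} (h : Sub b c) (k : Sub c d), incl h ≫ incl k = incl (sub_trans h k)
  incl_mono : ∀ {c d} (h : Sub c d), Mono (incl h)
  incl_factor : ∀ {b c d} (h : Sub b d) (k : Sub c d) (g : b ⟶ c), g ≫ incl k = incl h →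
    ∃ l : Sub b c, g = incl l


/-- A normal factorization `f = e u j`: `e` is a retraction of `c` onto a subobject `c'`, `u` is an
isomorphism of `c'` onto a subobject `d'` of `d`, and `j = j(d',d)`. -/
structure NormalFactorization {C : Type u} [SmallCategory C] [SubobjectCategory C] {c d : C}
    (f : c ⟶ d) where
  source : C
  target : C
  source_sub : SubobjectCategory.Sub source c
  target_sub : SubobjectCategory.Sub target d
  e : c ⟶ source
  u : source ⟶ target
  retraction : SubobjectCategory.incl source_sub ≫ e = 𝟙 source
  isIso : IsIso u
  fac : e ≫ u ≫ SubobjectCategory.incl target_sub = f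

/-! ### Cones and normal categories -/

/-- A cone with base the set of all objects: components `γ(c) : c ⟶ vertex` compatible with the
inclusions. -/
structure SubCone (C : Type u) [SmallCategory C] [SubobjectCategory C] where
  vertex : C
  app : ∀ c : C, c ⟶ vertex
  compat : ∀ {c d : C} (h : SubobjectCategory.Sub c d), SubobjectCategory.incl h ≫ app d = app c

/-- A cone is normal if one of its components is an isomorphism. -/
def SubCone.IsNormal {C : Type u} [SmallCategory C] [SubobjectCategory C] (γ : SubCone C) : Prop :=
  ∃ c, IsIso (γ.app c)

/-- A normal category. -/
class NormalCategory (C : Type u) [SmallCategory C] extends SubobjectCategory C where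
  exists_factorization : ∀ {c d : C} (f : c ⟶ d), Nonempty (NormalFactorization f)
  incl_splits : ∀ {c d : C} (h : Sub c d), ∃ e : d ⟶ c, incl h ≫ e = 𝟙 c
  exists_cone : ∀ c : C, ∃ γ : SubCone C, γ.IsNormal ∧
    ∃ h : γ.vertex = c, γ.app c = eqToHom h.symm

section
open SubobjectCategory

variable {C : Type u} [SmallCategory C] [NormalCategory C]

/-- The image of a morphism: the object `d'` in a normal factorization. -/
noncomputable def im {c d : C} (f : c ⟶ d) : C :=
  (NormalCategory.exists_factorization f).some.target

theorem im_sub {c d : C} (f : c ⟶ d) : Sub (im f) d :=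
  (NormalCategory.exists_factorization f).some.target_sub

/-- The epimorphic component `f° = e u` of a morphism `f = e u j`. It does not depend on the
normal factorization, see `epi_unique`. -/
noncomputable def epi {c d : C} (f : c ⟶ d) : c ⟶ im f :=
  (NormalCategory.exists_factorization f).some.e ≫ (NormalCategory.exists_factorization f).some.u

theorem epi_incl {c d : C} (f : c ⟶ d) : epi f ≫ incl (im_sub f) = f := by
  exact (Category.assoc _ _ _).trans (NormalCategory.exists_factorization f).some.fac

theorem epi_split {c d : C} (f : c ⟶ d) : ∃ s : im f ⟶ c, s ≫ epi f = 𝟙 _ := by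
  have key : ∀ F : NormalFactorization f, ∃ s : F.target ⟶ c, s ≫ F.e ≫ F.u = 𝟙 _ := by
    intro F
    have := F.isIso
    refine ⟨inv F.u ≫ incl F.source_sub, ?_⟩
    rw [Category.assoc, ← Category.assoc (incl _), F.retraction, Category.id_comp,
      IsIso.inv_hom_id]
  exact key _

theorem epi_unique {c d m : C} (f : c ⟶ d) (h : Sub m d) (q : c ⟶ m) (s : m ⟶ c)
    (hs : s ≫ q = 𝟙 m) (hq : q ≫ incl h = f) : ∃ e : im f = m, epi f ≫ eqToHom e = q := by
  obtain ⟨t, ht⟩ := epi_split f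
  have h1 : (t ≫ q) ≫ incl h = incl (im_sub f) := by
    calc (t ≫ q) ≫ incl h = t ≫ f := by rw [Category.assoc, hq]
      _ = t ≫ epi f ≫ incl (im_sub f) := by rw [epi_incl]
      _ = _ := by rw [← Category.assoc, ht, Category.id_comp]
  have h2 : (s ≫ epi f) ≫ incl (im_sub f) = incl h := by
    rw [Category.assoc, epi_incl, ← hq, ← Category.assoc, hs, Category.id_comp]
  obtain ⟨l1, -⟩ := incl_factor _ _ _ h1
  obtain ⟨l2, -⟩ := incl_factor _ _ _ h2
  have e : im f = m := sub_antisymm l1 l2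
  refine ⟨e, ?_⟩
  subst e
  have := incl_mono h
  rw [← cancel_mono (incl h), hq]
  simpa using epi_incl f

/-- The cone `γ * f`, with components `γ(c) f`. -/
def SubCone.star (γ : SubCone C) {d : C} (f : γ.vertex ⟶ d) : SubCone C where
  vertex := d
  app c := γ.app c ≫ f
  compat h := by rw [← Category.assoc, γ.compat]

/-- The product `γ · σ = γ * (σ(c_γ))°` of cones. -/
noncomputable def SubCone.mul (γ σ : SubCone C) : SubCone C :=
  γ.star (epi (σ.app γ.vertex))

/-- The idempotent normal cones, i.e. the idempotents of the semigroup of normal cones. -/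
def SubCone.IsIdempotentNormal (γ : SubCone C) : Prop :=
  γ.IsNormal ∧ γ.mul γ = γ

theorem SubCone.star_epi (γ : SubCone C) {d m : C} (f : γ.vertex ⟶ d) (h : Sub m d)
    (q : γ.vertex ⟶ m) (s : m ⟶ γ.vertex) (hs : s ≫ q = 𝟙 m) (hq : q ≫ incl h = f) :
    γ.star (epi f) = γ.star q := by
  obtain ⟨e, he⟩ := epi_unique f h q s hs hq
  subst e
  simp only [eqToHom_refl, Category.comp_id] at he
  rw [he]

/-! ### `H`-functors and the normal dual -/

/-- The set `H(γ;c) = {γ * f° : f : c_γ ⟶ c}` of cones. -/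
def SubCone.hset (γ : SubCone C) (c : C) : Set (SubCone C) :=
  {x | ∃ f : γ.vertex ⟶ c, x = γ.star (epi f)}

/-- The effect of `g : c ⟶ d` on a cone `x` whose vertex is a subobject of `c`. By
`SubCone.act_star` it sends `γ * f°` to `γ * (f g)°`, whatever the cone `γ` is. -/
noncomputable def SubCone.act (x : SubCone C) {c d : C} (h : Sub x.vertex c) (g : c ⟶ d) :
    SubCone C :=
  x.star (epi (incl h ≫ g))

theorem epi_comp {b c d : C} (f : b ⟶ c) (g : c ⟶ d) (h : Sub (im f) c) :
    ∃ s : im (incl h ≫ g) ⟶ b, s ≫ epi f ≫ epi (incl h ≫ g) = 𝟙 _ ∧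
      (epi f ≫ epi (incl h ≫ g)) ≫ incl (im_sub _) = f ≫ g := by
  obtain ⟨s, hs⟩ := epi_split f
  obtain ⟨t, ht⟩ := epi_split (incl h ≫ g)
  refine ⟨t ≫ s, ?_, ?_⟩
  · rw [Category.assoc, ← Category.assoc s, hs, Category.id_comp, ht]
  · rw [Category.assoc, epi_incl, ← Category.assoc, epi_incl]

theorem SubCone.act_star (γ : SubCone C) {c d : C} (f : γ.vertex ⟶ c) (g : c ⟶ d)
    (h : Sub (γ.star (epi f)).vertex c) :
    (γ.star (epi f)).act h g = γ.star (epi (f ≫ g)) := by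
  obtain ⟨s, hs, hq⟩ := epi_comp f g h
  rw [γ.star_epi (f ≫ g) _ _ s hs hq]
  simp [SubCone.act, SubCone.star]

variable (C) in
/-- The objects of the normal dual: the functors `H(ε;-)`, `ε` an idempotent normal cone. Such a
functor is determined by its values, since its effect on morphisms is `SubCone.act`. -/
@[ext]
structure NormalDual where
  sets : C → Set (SubCone C)
  exists_cone : ∃ ε : SubCone C, ε.IsIdempotentNormal ∧ ∀ c, sets c = ε.hset c

/-- `F = H(ε;-)` with `ε` an idempotent normal cone. -/
def NormalDual.IsGeneratedBy (F : NormalDual C) (ε : SubCone C) : Prop :=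
  ε.IsIdempotentNormal ∧ ∀ c, F.sets c = ε.hset c

theorem NormalDual.sub_of_mem (F : NormalDual C) {c : C} {x : SubCone C} (hx : x ∈ F.sets c) :
    Sub x.vertex c := by
  obtain ⟨ε, -, h⟩ := F.exists_cone
  rw [h] at hx
  obtain ⟨f, rfl⟩ := hx
  exact im_sub f

theorem NormalDual.act_mem (F : NormalDual C) {c d : C} {x : SubCone C} (hx : x ∈ F.sets c)
    (g : c ⟶ d) : x.act (F.sub_of_mem hx) g ∈ F.sets d := by
  obtain ⟨ε, -, h⟩ := F.exists_cone
  have hx' := hx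
  rw [h] at hx'
  obtain ⟨f, rfl⟩ := hx'
  rw [ε.act_star, h]
  exact ⟨f ≫ g, rfl⟩

/-- The underlying set-valued functor `H(ε;-)`. -/
noncomputable def NormalDual.toFunctor (F : NormalDual C) : C ⥤ Type u where
  obj c := F.sets c
  map g := TypeCat.ofHom fun x => ⟨x.1.act (F.sub_of_mem x.2) g, F.act_mem x.2 g⟩
  map_id c := by
    ext ⟨x, hx⟩
    obtain ⟨ε, -, h⟩ := F.exists_cone
    have hx' := hx
    rw [h] at hx'
    obtain ⟨f, rfl⟩ := hx'
    change (ε.star (epi f)).act _ (𝟙 c) = ε.star (epi f)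
    rw [ε.act_star, Category.comp_id]
  map_comp {c d e} g k := by
    ext ⟨x, hx⟩
    obtain ⟨ε, -, h⟩ := F.exists_cone
    have hx' := hx
    rw [h] at hx'
    obtain ⟨f, rfl⟩ := hx'
    change (ε.star (epi f)).act _ (g ≫ k) = ((ε.star (epi f)).act _ g).act _ k
    have key : ∀ y (hy : y = ε.star (epi (f ≫ g))) (p : Sub y.vertex d),
        y.act p k = ε.star (epi ((f ≫ g) ≫ k)) := by
      rintro y rfl p
      exact ε.act_star _ _ _
    rw [key _ (ε.act_star f g _), ε.act_star, Category.assoc]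

/-- Morphisms of the normal dual are the natural transformations. -/
noncomputable instance : SmallCategory (NormalDual C) where
  Hom F G := F.toFunctor ⟶ G.toFunctor
  id F := 𝟙 F.toFunctor
  comp α β := NatTrans.vcomp α β

/-- The full embedding of the normal dual into the category of set-valued functors. -/
noncomputable def NormalDual.forget (C : Type u) [SmallCategory C] [NormalCategory C] :
    NormalDual C ⥤ (C ⥤ Type u) where
  obj F := F.toFunctor
  map α := α

/-- The inclusion of a subfunctor. -/
noncomputable def NormalDual.inclusion {F G : NormalDual C} (h : ∀ c, F.sets c ⊆ G.sets c) :
    F ⟶ G :=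
  (({ app := fun c => TypeCat.ofHom fun x => ⟨x.1, h c x.2⟩ } : F.toFunctor ⟶ G.toFunctor))

/-- In the normal dual, the subobjects of a functor are its subfunctors. -/
noncomputable instance : SubobjectCategory (NormalDual C) where
  Sub F G := ∀ c, F.sets c ⊆ G.sets c
  sub_refl F c := le_rfl
  sub_trans h k c := (h c).trans (k c)
  sub_antisymm h k := NormalDual.ext (funext fun c => (h c).antisymm (k c))
  incl h := NormalDual.inclusion h
  incl_refl F := rfl
  incl_comp h k := rfl
  incl_mono {F G} h := ⟨fun {E} α β hαβ => by
    apply NatTrans.ext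
    funext c
    ext x
    have := congrArg (fun t : E.toFunctor ⟶ G.toFunctor => ((t.app c) x).1) hαβ
    exact Subtype.ext this⟩
  incl_factor {E F G} h k α hα := by
    have key : ∀ c (x : E.sets c), ((NatTrans.app (F := E.toFunctor) (G := F.toFunctor) α c) x).1
        = x.1 := by
      intro c x
      exact congrArg (fun t : E.toFunctor ⟶ G.toFunctor => ((t.app c) x).1) hα
    refine ⟨fun c x hx => ?_, ?_⟩
    · have := key c ⟨x, hx⟩
      rw [← show _ = x from this]
      exact Subtype.property _
    · apply NatTrans.ext
      funext c
      ext x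
      exact Subtype.ext (key c x)

/-- The `M`-set of an `H`-functor `F = H(ε;-)`: the objects at which the component of `ε` is an
isomorphism. -/
def NormalDual.mset (F : NormalDual C) : Set C :=
  {c | ∃ ε : SubCone C, F.IsGeneratedBy ε ∧ IsIso (ε.app c)}

end

/-! ### Cross-connections and duality -/

section
open SubobjectCategory

/-- A local isomorphism: an inclusion preserving, fully faithful functor that restricts, for every
object `c`, to an isomorphism from the full subcategory of the subobjects of `c` onto the full
subcategory of the subobjects of `F(c)` (for a fully faithful functor: a bijection between the
objects of the two). -/
structure IsLocalIso {C D : Type u} [SmallCategory C] [SmallCategory D] [SubobjectCategory C]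
    [SubobjectCategory D] (F : C ⥤ D) : Prop where
  map_sub : ∀ {c d : C} (h : Sub c d), ∃ k : Sub (F.obj c) (F.obj d), F.map (incl h) = incl k
  full : F.Full
  faithful : F.Faithful
  ideal : ∀ c : C, Set.BijOn F.obj {b | Sub b c} {b | Sub b (F.obj c)}

variable {C D : Type u} [SmallCategory C] [SmallCategory D] [NormalCategory C] [NormalCategory D]

/-- `(D, C; Γ)` is a cross-connection from `D` to `C`. -/
structure IsCrossConnection (Γ : D ⥤ NormalDual C) : Prop where
  isLocalIso : IsLocalIso Γ
  exists_mem_mset : ∀ c : C, ∃ d : D, c ∈ (Γ.obj d).mset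

/-- The bifunctor `Γ(-,-) : C × D ⥤ Set`, `Γ(c,d) = Γ(d)(c)`, of a functor `Γ : D ⥤ N*C`. -/
noncomputable def bifunctorLeft (Γ : D ⥤ NormalDual C) : C × D ⥤ Type u :=
  CategoryTheory.Prod.swap C D ⋙ Functor.uncurry.obj (Γ ⋙ NormalDual.forget C)

/-- The bifunctor `Δ(-,-) : C × D ⥤ Set`, `Δ(c,d) = Δ(c)(d)`, of a functor `Δ : C ⥤ N*D`. -/
noncomputable def bifunctorRight (Δ : C ⥤ NormalDual D) : C × D ⥤ Type u :=
  Functor.uncurry.obj (Δ ⋙ NormalDual.forget D)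

/-- The cone in `C` underlying an element of `Γ(c,d)`. -/
def coneLeft {Γ : D ⥤ NormalDual C} {c : C} {d : D} (x : (bifunctorLeft Γ).obj (c, d)) :
    SubCone C :=
  (show (Γ.obj d).sets c from x).1

/-- The cone in `D` underlying an element of `Δ(c,d)`. -/
def coneRight {Δ : C ⥤ NormalDual D} {c : C} {d : D} (x : (bifunctorRight Δ).obj (c, d)) :
    SubCone D :=
  (show (Δ.obj c).sets d from x).1

/-- `Δ` is a dual cross-connection of the cross-connection `Γ`, with associated duality `χ`:
`c ∈ MΓ(d)` if and only if `d ∈ MΔ(c)`, and `χ` is a natural isomorphism `Γ(-,-) ≅ Δ(-,-)` which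
sends the idempotent cone `γ(c,d)` with vertex `c` and `Γ(d) = H(γ(c,d);-)` to the idempotent cone
`δ(c,d)` with vertex `d` and `Δ(c) = H(δ(c,d);-)`, whenever `c ∈ MΓ(d)`. -/
structure IsDuality (Γ : D ⥤ NormalDual C) (Δ : C ⥤ NormalDual D)
    (χ : bifunctorLeft Γ ≅ bifunctorRight Δ) : Prop where
  left : IsCrossConnection Γ
  right : IsCrossConnection Δ
  mem_mset_iff : ∀ (c : C) (d : D), c ∈ (Γ.obj d).mset ↔ d ∈ (Δ.obj c).mset
  map_idempotent : ∀ (c : C) (d : D) (x : (bifunctorLeft Γ).obj (c, d)),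
    (coneLeft x).vertex = c → (Γ.obj d).IsGeneratedBy (coneLeft x) →
      (coneRight (χ.hom.app (c, d) x)).vertex = d ∧
        (Δ.obj c).IsGeneratedBy (coneRight (χ.hom.app (c, d) x))

end

end CrossConn

namespace CrossConn
open SubobjectCategory

theorem SubCone.isIdempotentNormal_of_app {C : Type u} [SmallCategory C] [NormalCategory C]
    (γ : SubCone C) (h : γ.app γ.vertex = 𝟙 _) : γ.IsIdempotentNormal := by
  refine ⟨⟨γ.vertex, by rw [h]; infer_instance⟩, ?_⟩
  have := γ.star_epi (γ.app γ.vertex) (sub_refl _) (𝟙 _) (𝟙 _) (by simp) (by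
    rw [incl_refl, h]; simp)
  rw [SubCone.mul, this]
  simp [SubCone.star]

/-! ### The powerset category -/

/-- The objects of the powerset category of `X`: the non-empty proper subsets of `X`. -/
@[ext]
structure PowersetCat (X : Type u) where
  set : Set X
  nonempty : set.Nonempty
  ne_univ : set ≠ Set.univ

/-- The morphisms from `A` to `B` are all the functions from `A` to `B`. -/
instance (X : Type u) : SmallCategory (PowersetCat X) where
  Hom A B := A.set → B.set
  id A := fun x => x
  comp f g := fun x => g (f x)

namespace PowersetCat

variable {X : Type u}

theorem isIso_of_bijective {A B : PowersetCat X} (f : A ⟶ B)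
    (h : Function.Bijective (f : A.set → B.set)) : IsIso f := by
  let e := Equiv.ofBijective (f : A.set → B.set) h
  exact ⟨⟨(e.symm : B.set → A.set), funext fun x => e.symm_apply_apply x,
    funext fun x => e.apply_symm_apply x⟩⟩

/-- The subobjects are given by the inclusions of subsets. -/
instance : SubobjectCategory (PowersetCat X) where
  Sub A B := A.set ⊆ B.set
  sub_refl A := le_rfl
  sub_trans h k := h.trans k
  sub_antisymm h k := PowersetCat.ext (h.antisymm k)
  incl h := fun x => ⟨x.1, h x.2⟩
  incl_refl A := rfl
  incl_comp h k := rfl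
  incl_mono {A B} h := ⟨fun {E} f g hfg => by
    funext x
    have := congrArg (fun t : E ⟶ B => (t x).1) hfg
    exact Subtype.ext this⟩
  incl_factor {A B D} h k g hg := by
    have key : ∀ x : A.set, (g x).1 = x.1 := fun x =>
      congrArg (fun t : A ⟶ D => (t x).1) hg
    exact ⟨fun x hx => (congrArg (· ∈ B.set) (key ⟨x, hx⟩)).mp (g ⟨x, hx⟩).2, funext fun x => Subtype.ext (key x)⟩

/-- The subset of an object that contains the values of a function. -/
def ofSubset (A : PowersetCat X) (S : Set X) (hS : S.Nonempty) (h : S ⊆ A.set) :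
    PowersetCat X where
  set := S
  nonempty := hS
  ne_univ e := A.ne_univ (Set.univ_subset_iff.1 (e ▸ h))

theorem exists_factorization {A B : PowersetCat X} (f : A ⟶ B) :
    Nonempty (NormalFactorization f) := by
  classical
  have : Nonempty A.set := A.nonempty.to_subtype
  let f' : A.set → B.set := f
  let s : A.set → A.set := fun a => Function.invFun f' (f' a)
  have hs : ∀ a, f' (s a) = f' a := fun a => Function.invFun_eq ⟨a, rfl⟩
  have hs' : ∀ a b, f' a = f' b → s a = s b := fun a b h => by simp only [s, h]
  let S : PowersetCat X := A.ofSubset (Set.range fun a => (s a).1) (Set.range_nonempty _)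
    (by rintro _ ⟨a, rfl⟩; exact (s a).2)
  let T : PowersetCat X := B.ofSubset (Set.range fun a => (f' a).1) (Set.range_nonempty _)
    (by rintro _ ⟨a, rfl⟩; exact (f' a).2)
  have hSA : S.set ⊆ A.set := by rintro _ ⟨a, rfl⟩; exact (s a).2
  let u : S.set → T.set := fun x => ⟨(f' ⟨x.1, hSA x.2⟩).1, ⟨_, rfl⟩⟩
  refine ⟨{
    source := S
    target := T
    source_sub := hSA
    target_sub := by rintro _ ⟨a, rfl⟩; exact (f' a).2
    e := fun a => (⟨(s a).1, ⟨a, rfl⟩⟩ : S.set)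
    u := u
    retraction := ?_
    isIso := ?_
    fac := ?_ }⟩
  · funext x
    obtain ⟨x, a, rfl⟩ := x
    have h := congrArg Subtype.val (hs' _ _ (hs a))
    exact Subtype.ext h
  · refine isIso_of_bijective _ ⟨?_, ?_⟩
    · rintro ⟨_, a, rfl⟩ ⟨_, b, rfl⟩ h
      have h0 : (u _).1 = (u _).1 := congrArg Subtype.val h
      have h' : f' (s a) = f' (s b) := Subtype.ext h0
      rw [hs, hs] at h'
      have h2 := congrArg Subtype.val (hs' _ _ h')
      exact Subtype.ext h2
    · rintro ⟨_, a, rfl⟩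
      have h2 := congrArg Subtype.val (hs a)
      exact ⟨⟨_, a, rfl⟩, Subtype.ext h2⟩
  · funext a
    have h2 := congrArg Subtype.val (hs a)
    exact Subtype.ext h2

theorem exists_retraction (A : PowersetCat X) :
    ∃ e : X → X, (∀ x, e x ∈ A.set) ∧ ∀ x ∈ A.set, e x = x := by
  classical
  obtain ⟨a, ha⟩ := A.nonempty
  refine ⟨fun x => if x ∈ A.set then x else a, fun x => ?_, fun x hx => if_pos hx⟩
  by_cases hx : x ∈ A.set <;> simp [hx, ha]

/-- The cone with vertex `A` defined by a function `a : X → A`: its components are the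
restrictions of `a`. -/
def coneTo (A : PowersetCat X) (a : X → A.set) : SubCone (PowersetCat X) where
  vertex := A
  app _ := fun x => a x.1
  compat _ := rfl

instance : NormalCategory (PowersetCat X) where
  exists_factorization := exists_factorization
  incl_splits {A B} h := by
    obtain ⟨e, he, he'⟩ := A.exists_retraction
    exact ⟨fun x => ⟨e x.1, he _⟩, funext fun x => Subtype.ext (he' _ x.2)⟩
  exists_cone A := by
    obtain ⟨e, he, he'⟩ := A.exists_retraction
    have : (A.coneTo fun x => ⟨e x, he x⟩).app A = 𝟙 A :=
      funext fun x => Subtype.ext (he' _ x.2)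
    exact ⟨A.coneTo fun x => ⟨e x, he x⟩, ⟨A, by rw [this]; exact inferInstanceAs (IsIso (𝟙 A))⟩, rfl, this⟩

end PowersetCat

/-! ### The category of partitions -/

/-- The objects of the category of partitions of `X`: the non-identity partitions `π` of `X`, given
as equivalence relations; the blocks are the elements of `Quotient rel`. The object `π` stands for
the set `π̄` of all the functions from the set of blocks of `π` to `X`. -/
@[ext]
structure PartitionCat (X : Type u) where
  rel : Setoid X
  ne_bot : rel ≠ ⊥

/-- The morphisms from `π̄₁` to `π̄₂` are the maps `η* : π̄₁ → π̄₂`, `α ↦ η α`, where `η` is a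
function from the blocks of `π₂` to the blocks of `π₁`; such a morphism is given by `η`, see
`PartitionCat.star_injective`. -/
instance (X : Type u) : SmallCategory (PartitionCat X) where
  Hom π₁ π₂ := Quotient π₂.rel → Quotient π₁.rel
  id π := fun x => x
  comp f g := fun x => f (g x)

namespace PartitionCat

variable {X : Type u}

/-- The map `η* : π̄₁ → π̄₂`. -/
def star {π₁ π₂ : PartitionCat X} (η : π₁ ⟶ π₂) :
    (Quotient π₁.rel → X) → (Quotient π₂.rel → X) :=
  fun α x => α (η x)

theorem star_comp {π₁ π₂ π₃ : PartitionCat X} (η : π₁ ⟶ π₂) (μ : π₂ ⟶ π₃) :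
    star (η ≫ μ) = star μ ∘ star η := rfl

theorem star_injective [Nontrivial X] (π₁ π₂ : PartitionCat X) :
    Function.Injective (star : (π₁ ⟶ π₂) → _) := by
  classical
  intro η μ h
  obtain ⟨a, b, hab⟩ := exists_pair_ne X
  funext x
  by_contra hx
  have := congrFun (congrFun h fun y => if y = η x then a else b) x
  simp only [star, if_true, if_neg (Ne.symm hx)] at this
  exact hab this

/-- The canonical map from the blocks of a partition to the blocks of a coarser one. -/
def coarsen {r s : Setoid X} (h : r ≤ s) : Quotient r → Quotient s :=
  Quotient.map' (s₁ := r) (s₂ := s) id fun _ _ hxy => h hxy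

theorem coarsen_surjective {r s : Setoid X} (h : r ≤ s) : Function.Surjective (coarsen h) := by
  intro y
  induction y using Quotient.inductionOn with
  | h x => exact ⟨Quotient.mk r x, rfl⟩

theorem isIso_of_bijective {π₁ π₂ : PartitionCat X} (f : π₁ ⟶ π₂)
    (h : Function.Bijective (f : Quotient π₂.rel → Quotient π₁.rel)) : IsIso f := by
  let e := Equiv.ofBijective (f : Quotient π₂.rel → Quotient π₁.rel) h
  exact ⟨⟨(e.symm : Quotient π₁.rel → Quotient π₂.rel), funext fun x => e.apply_symm_apply x,
    funext fun x => e.symm_apply_apply x⟩⟩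

/-- `π̄₁ ⊆ π̄₂` if `π₂` refines `π₁`, and the inclusion is `ν*` where `ν` sends a block of `π₂` to
the block of `π₁` that contains it. -/
instance : SubobjectCategory (PartitionCat X) where
  Sub π₁ π₂ := π₂.rel ≤ π₁.rel
  sub_refl A := le_rfl
  sub_trans h k := le_trans k h
  sub_antisymm h k := PartitionCat.ext (le_antisymm k h)
  incl h := coarsen h
  incl_refl A := funext fun x => Quotient.inductionOn x fun _ => rfl
  incl_comp h k := funext fun x => Quotient.inductionOn x fun _ => rfl
  incl_mono {A B} h := ⟨fun {E} f g hfg => by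
    funext x
    obtain ⟨y, rfl⟩ := coarsen_surjective h x
    exact congrFun hfg y⟩
  incl_factor {A B D} h k g hg := by
    have key : ∀ x : X, g (Quotient.mk _ x) = Quotient.mk _ x := fun x =>
      congrFun hg (Quotient.mk _ x)
    refine ⟨fun {x y} hxy => ?_, funext fun x => Quotient.inductionOn x key⟩
    have e : Quotient.mk B.rel x = Quotient.mk B.rel y := Quotient.sound hxy
    exact Quotient.exact ((key x).symm.trans ((congrArg g e).trans (key y)))

/-- The partition whose blocks are the fibres of a function on the blocks of a given one. -/
def fibres {Y : Type*} (π : PartitionCat X) (f : Quotient π.rel → Y) : PartitionCat X where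
  rel := Setoid.ker fun x => f (Quotient.mk _ x)
  ne_bot h := π.ne_bot (le_bot_iff.1 (h ▸ fun {x y} hxy =>
    congrArg f (Quotient.sound hxy : Quotient.mk π.rel x = Quotient.mk π.rel y)))

theorem le_fibres {Y : Type*} (π : PartitionCat X) (f : Quotient π.rel → Y) :
    π.rel ≤ (π.fibres f).rel := fun {x y} hxy =>
  congrArg f (Quotient.sound hxy : Quotient.mk π.rel x = Quotient.mk π.rel y)

/-- The injective map induced by a function on its fibres. -/
def fibreMap {Y : Type*} (π : PartitionCat X) (f : Quotient π.rel → Y) :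
    Quotient (π.fibres f).rel → Y :=
  Quotient.lift (s := (π.fibres f).rel) (fun x => f (Quotient.mk _ x)) fun _ _ h => h

theorem nonempty_quotient (π : PartitionCat X) : Nonempty (Quotient π.rel) := by
  by_contra h
  refine π.ne_bot (le_bot_iff.1 fun {x y} _ => ?_)
  exact (h ⟨Quotient.mk _ x⟩).elim

theorem exists_factorization {π₁ π₂ : PartitionCat X} (f : π₁ ⟶ π₂) :
    Nonempty (NormalFactorization f) := by
  classical
  have := π₁.nonempty_quotient
  have := π₂.nonempty_quotient
  let η : Quotient π₂.rel → Quotient π₁.rel := f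
  let r : Quotient π₁.rel → Quotient π₁.rel := fun y => η (Function.invFun η y)
  have hr : ∀ x, r (η x) = η x := fun x => Function.invFun_eq ⟨x, rfl⟩
  have hr' : ∀ y, r (r y) = r y := fun y => hr _
  let S := π₁.fibres r
  let T := π₂.fibres η
  let u : Quotient T.rel → Quotient S.rel := fun y => coarsen (π₁.le_fibres r) (π₂.fibreMap η y)
  refine ⟨{
    source := S
    target := T
    source_sub := π₁.le_fibres r
    target_sub := π₂.le_fibres η
    e := π₁.fibreMap r
    u := u
    retraction := ?_
    isIso := ?_
    fac := ?_ }⟩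
  · funext x
    induction x using Quotient.inductionOn with
    | h x =>
      change coarsen (π₁.le_fibres r) (r (Quotient.mk _ x)) = Quotient.mk _ x
      obtain ⟨y, hy⟩ := Quotient.exists_rep (r (Quotient.mk _ x))
      rw [← hy]
      refine Quotient.sound ?_
      change r (Quotient.mk _ y) = r (Quotient.mk _ x)
      rw [hy, hr']
  · refine isIso_of_bijective _ ⟨?_, ?_⟩
    · intro x y
      induction x using Quotient.inductionOn with
      | h x =>
      induction y using Quotient.inductionOn with
      | h y =>
        intro h
        refine Quotient.sound ?_
        change η (Quotient.mk _ x) = η (Quotient.mk _ y)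
        have h' : π₁.fibreMap r (coarsen (π₁.le_fibres r) (η (Quotient.mk _ x))) =
          π₁.fibreMap r (coarsen (π₁.le_fibres r) (η (Quotient.mk _ y))) :=
            congrArg (π₁.fibreMap r) h
        have h2 : ∀ z, π₁.fibreMap r (coarsen (π₁.le_fibres r) z) = r z := fun z =>
          Quotient.inductionOn z fun _ => rfl
        rwa [h2, h2, hr, hr] at h'
    · intro x
      induction x using Quotient.inductionOn with
      | h x =>
        obtain ⟨z, hz⟩ := Quotient.exists_rep (Function.invFun η (Quotient.mk _ x))
        refine ⟨Quotient.mk _ z, ?_⟩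
        change coarsen (π₁.le_fibres r) (η (Quotient.mk _ z)) = Quotient.mk _ x
        have hz' : η (Quotient.mk _ z) = r (Quotient.mk _ x) := congrArg η hz
        rw [hz']
        obtain ⟨y, hy⟩ := Quotient.exists_rep (r (Quotient.mk _ x))
        rw [← hy]
        refine Quotient.sound ?_
        change r (Quotient.mk _ y) = r (Quotient.mk _ x)
        rw [hy, hr']
  · funext x
    induction x using Quotient.inductionOn with
    | h x =>
      have h2 : ∀ z, π₁.fibreMap r (coarsen (π₁.le_fibres r) z) = r z := fun z =>
        Quotient.inductionOn z fun _ => rfl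
      exact (h2 _).trans (hr _)

theorem exists_idempotent (π : PartitionCat X) :
    ∃ e : X → X, Setoid.ker e = π.rel ∧ ∀ x, e (e x) = e x := by
  refine ⟨fun x => (Quotient.mk π.rel x).out, ?_, fun x => ?_⟩
  · ext x y
    change (Quotient.mk π.rel x).out = (Quotient.mk π.rel y).out ↔ π.rel x y
    rw [Quotient.out_inj]
    exact Quotient.eq
  · simp

/-- The cone with vertex `π̄` defined by a transformation `a` that is constant on the blocks of
`π`: its component at `ᾱ` is given by the map sending the block of `x` in `π` to the block of
`(x)a` in `α`. -/
def coneTo (π : PartitionCat X) (a : X → X) (h : π.rel ≤ Setoid.ker a) :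
    SubCone (PartitionCat X) where
  vertex := π
  app α := Quotient.lift (s := π.rel) (fun x => Quotient.mk α.rel (a x))
    fun _ _ hxy => congrArg _ (h hxy)
  compat _ := funext fun x => Quotient.inductionOn x fun _ => rfl

instance : NormalCategory (PartitionCat X) where
  exists_factorization := exists_factorization
  incl_splits {A B} h := by
    refine ⟨fun x => Quotient.mk _ x.out, funext fun x => ?_⟩
    exact Quotient.out_eq x
  exists_cone π := by
    obtain ⟨e, he, he'⟩ := π.exists_idempotent
    have : (π.coneTo e he.ge).app π = 𝟙 π := by
      funext x
      induction x using Quotient.inductionOn with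
      | h x => exact Quotient.sound (he ▸ he' x)
    exact ⟨π.coneTo e he.ge, ⟨π, by rw [this]; exact inferInstanceAs (IsIso (𝟙 π))⟩, rfl, this⟩

end PartitionCat
end CrossConn

namespace CrossConn
open SubobjectCategory

variable {X : Type u}

/-! ### Singular transformations -/

/-- `Sing(X)`: the non-invertible transformations of `X`. -/
def Sing (X : Type u) : Set (X → X) :=
  {a | ¬ Function.Bijective a}

/-- `{a ∈ Sing(X) : Im a ⊆ A, π̄_a ⊆ π̄}`, where `π_a` is the partition of `X` induced by `a`. -/
def transSet (A : PowersetCat X) (π : PartitionCat X) : Set (X → X) :=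
  {a | a ∈ Sing X ∧ Set.range a ⊆ A.set ∧ π.rel ≤ Setoid.ker a}

/-- The map on the blocks of `π` induced by `a`. -/
def descend {A : PowersetCat X} {π : PartitionCat X} (a : transSet A π) (y : Quotient π.rel) :
    A.set :=
  Quotient.lift (s := π.rel) (fun x => (⟨a.1 x, a.2.2.1 ⟨x, rfl⟩⟩ : A.set))
    (fun _ _ h => Subtype.ext (a.2.2.2 h)) y

theorem mem_transSet {A : PowersetCat X} {π : PartitionCat X} {a : X → X}
    (h1 : ∀ x, a x ∈ A.set) (h2 : π.rel ≤ Setoid.ker a) : a ∈ transSet A π := by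
  refine ⟨fun h => A.ne_univ ?_, by rintro _ ⟨x, rfl⟩; exact h1 x, h2⟩
  rw [Set.eq_univ_iff_forall]
  intro y
  obtain ⟨x, rfl⟩ := h.2 y
  exact h1 x

/-- The map `a ↦ u a f`, where `u` is a function from the blocks of `π'` to the blocks of `π` and
`f : A → B`: a point `x` goes to its block in `π'`, then to a block in `π` by `u`, then to a point
of `A` by `a`, then to `B` by `f`. -/
def transMap {A B : PowersetCat X} {π π' : PartitionCat X} (f : A ⟶ B) (u : π ⟶ π')
    (a : transSet A π) : transSet B π' :=
  ⟨fun x => (f (descend a (u (Quotient.mk _ x)))).1,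
    mem_transSet (fun _ => Subtype.property _) fun {x y} hxy =>
      congrArg (fun t => (f (descend a (u t))).1)
        (Quotient.sound hxy : Quotient.mk π'.rel x = Quotient.mk π'.rel y)⟩

theorem descend_transMap {A B : PowersetCat X} {π π' : PartitionCat X} (f : A ⟶ B) (u : π ⟶ π')
    (a : transSet A π) (y : Quotient π'.rel) :
    descend (transMap f u a) y = f (descend a (u y)) :=
  Quotient.inductionOn y fun _ => rfl

/-- The bifunctor `(A,π̄) ↦ {a ∈ Sing(X) : Im a ⊆ A, π̄_a ⊆ π̄}`, `(f,u*) ↦ (a ↦ u a f)`. -/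
def transBifunctor (X : Type u) : PowersetCat X × PartitionCat X ⥤ Type u where
  obj P := transSet P.1 P.2
  map g := TypeCat.ofHom (transMap g.1 g.2)
  map_id P := by
    ext a x
    rfl
  map_comp g k := by
    ext a x
    exact (congrArg (fun t => (k.1 t).1) (descend_transMap g.1 g.2 a _)).symm

/-- The bifunctor associated with a functor `Γ : Π(X) ⥤ Π(X)`:
`Γ(A,π̄) = {a ∈ Sing(X) : Im a ⊆ A, π̄_a ⊆ Γ(π̄)}` and `Γ(f,v*) : a ↦ u a f` with `u* = Γ(v*)`. -/
def gammaBifunctor (Γ : PartitionCat X ⥤ PartitionCat X) :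
    PowersetCat X × PartitionCat X ⥤ Type u :=
  (𝟭 (PowersetCat X)).prod Γ ⋙ transBifunctor X

/-- The bifunctor associated with a functor `Δ : 𝒫(X) ⥤ 𝒫(X)`:
`Δ(A,π̄) = {a ∈ Sing(X) : Im a ⊆ Δ(A), π̄_a ⊆ π̄}` and `Δ(f,v*) : a ↦ v a g` with `g = Δ(f)`. -/
def deltaBifunctor (Δ : PowersetCat X ⥤ PowersetCat X) :
    PowersetCat X × PartitionCat X ⥤ Type u :=
  Δ.prod (𝟭 (PartitionCat X)) ⋙ transBifunctor X

/-- The transformation underlying an element of `Γ(A,π̄)`. -/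
def gammaTrans {Γ : PartitionCat X ⥤ PartitionCat X} {A : PowersetCat X} {π : PartitionCat X}
    (a : (gammaBifunctor Γ).obj (A, π)) : X → X :=
  (show transSet A (Γ.obj π) from a).1

/-- The transformation underlying an element of `Δ(A,π̄)`. -/
def deltaTrans {Δ : PowersetCat X ⥤ PowersetCat X} {A : PowersetCat X} {π : PartitionCat X}
    (a : (deltaBifunctor Δ).obj (A, π)) : X → X :=
  (show transSet (Δ.obj A) π from a).1

/-! ### The functors induced by a permutation -/

/-- The functor `θ` on the powerset category: `A ↦ θ(A)` and `f ↦ θ⁻¹ f θ` (composition from left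
to right). -/
def powersetPerm (θ : Equiv.Perm X) : PowersetCat X ⥤ PowersetCat X where
  obj A :=
    { set := θ '' A.set
      nonempty := A.nonempty.image θ
      ne_univ := fun h => A.ne_univ (by
        rw [← Set.preimage_image_eq A.set θ.injective, h, Set.preimage_univ]) }
  map {A B} f := fun y =>
    ⟨θ (f ⟨θ.symm y.1, Set.mem_image_equiv.1 y.2⟩).1, _, Subtype.property _, rfl⟩
  map_id A := funext fun y => Subtype.ext (θ.apply_symm_apply _)
  map_comp f g := by
    funext y
    refine Subtype.ext ?_
    exact congrArg (fun t => θ (g t).1) (Subtype.ext (θ.symm_apply_apply _).symm)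

/-- The partition `θ⁻¹(σ)`, whose blocks are the preimages `θ⁻¹(B)` of the blocks `B` of `σ`. -/
def preimagePartition (θ : Equiv.Perm X) (σ : PartitionCat X) : PartitionCat X where
  rel := Setoid.comap θ σ.rel
  ne_bot h := σ.ne_bot (le_bot_iff.1 fun {x y} hxy => by
    have : Setoid.comap θ σ.rel (θ.symm x) (θ.symm y) := by
      rw [Setoid.comap_rel]; simpa using hxy
    rw [h] at this
    exact θ.symm.injective this)

/-- `θ` as a bijection from the blocks of `θ⁻¹(σ)` to the blocks of `σ`. -/
def blockEquiv (θ : Equiv.Perm X) (σ : PartitionCat X) :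
    Quotient (preimagePartition θ σ).rel ≃ Quotient σ.rel where
  toFun := Quotient.map' (s₁ := (preimagePartition θ σ).rel) (s₂ := σ.rel) θ fun _ _ h => h
  invFun := Quotient.map' (s₁ := σ.rel) (s₂ := (preimagePartition θ σ).rel) θ.symm
    fun x y h => by
      change σ.rel (θ (θ.symm x)) (θ (θ.symm y))
      simpa using h
  left_inv y := Quotient.inductionOn y fun x => congrArg (Quotient.mk _) (θ.symm_apply_apply x)
  right_inv y := Quotient.inductionOn y fun x => congrArg (Quotient.mk _) (θ.apply_symm_apply x)

/-- The functor `θ` on the category of partitions: `σ̄ ↦ θ⁻¹(σ)` (barred) and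
`η* ↦ (θ η θ⁻¹)*` (composition from left to right). -/
def partitionPerm (θ : Equiv.Perm X) : PartitionCat X ⥤ PartitionCat X where
  obj σ := preimagePartition θ σ
  map {σ₁ σ₂} η := fun y => (blockEquiv θ σ₁).symm (η (blockEquiv θ σ₂ y))
  map_id σ := funext fun y => (blockEquiv θ σ).symm_apply_apply y
  map_comp {σ₁ σ₂ σ₃} η μ := by
    funext y
    change _ = (blockEquiv θ σ₁).symm (η (blockEquiv θ σ₂ ((blockEquiv θ σ₂).symm _)))
    rw [Equiv.apply_symm_apply]
    rfl

/-! ### Normal cones defined by singular transformations -/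

/-- The image of a transformation, as an object of the powerset category. -/
def imageObj [Nonempty X] (a : X → X) (h : Set.range a ≠ Set.univ) : PowersetCat X :=
  ⟨Set.range a, Set.range_nonempty a, h⟩

/-- The cone `ρ^a` in the powerset category defined by a transformation `a`: its vertex is `Im a`
and its components are the restrictions of `a`. -/
def rho [Nonempty X] (a : X → X) (h : Set.range a ≠ Set.univ) : SubCone (PowersetCat X) :=
  (imageObj a h).coneTo fun x => ⟨a x, x, rfl⟩

/-- The cone `σ^a` in the category of partitions defined by a transformation `a`: its vertex is
`π̄_a`, and its component at `ᾱ` is given by the map sending the block of `x` in `π_a` to the block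
of `(x)a` in `α`. -/
def sigma (a : X → X) (h : Setoid.ker a ≠ ⊥) : SubCone (PartitionCat X) :=
  (⟨Setoid.ker a, h⟩ : PartitionCat X).coneTo a le_rfl

theorem range_ne_univ {A : PowersetCat X} {π : PartitionCat X} (a : transSet A π) :
    Set.range a.1 ≠ Set.univ := fun h => A.ne_univ (Set.univ_subset_iff.1 (h ▸ a.2.2.1))

theorem ker_ne_bot {A : PowersetCat X} {π : PartitionCat X} (a : transSet A π) :
    Setoid.ker a.1 ≠ ⊥ := fun h => π.ne_bot (le_bot_iff.1 (h ▸ a.2.2.2))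

/-- `a ↦ ρ^a` on `transSet A π`. -/
def rhoCone [Nonempty X] {A : PowersetCat X} {π : PartitionCat X} (a : transSet A π) :
    SubCone (PowersetCat X) :=
  rho a.1 (range_ne_univ a)

/-- `a ↦ σ^a` on `transSet A π`. -/
def sigmaCone {A : PowersetCat X} {π : PartitionCat X} (a : transSet A π) :
    SubCone (PartitionCat X) :=
  sigma a.1 (ker_ne_bot a)

theorem SubCone.star_eq {C : Type u} [SmallCategory C] [NormalCategory C] (γ δ : SubCone C)
    (q : γ.vertex ⟶ δ.vertex) (h : ∀ c, γ.app c ≫ q = δ.app c) : γ.star q = δ := by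
  obtain ⟨v, t, ht⟩ := δ
  change γ.vertex ⟶ v at q
  have : t = fun c => γ.app c ≫ q := funext fun c => (h c).symm
  subst this
  rfl

theorem rhoCone_injective [Nontrivial X] (A : PowersetCat X) (π : PartitionCat X) :
    Function.Injective (rhoCone : transSet A π → _) := by
  intro a b h
  refine Subtype.ext (funext fun x => ?_)
  obtain ⟨y, hy⟩ := exists_ne x
  let S : PowersetCat X := ⟨{x}, ⟨x, rfl⟩, fun e => hy (e.symm ▸ Set.mem_univ y : y ∈ ({x} : Set X))⟩
  exact congrArg (fun γ : SubCone (PowersetCat X) => (γ.app S ⟨x, rfl⟩).1) h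

theorem PowersetCat.exists_separating (A : PowersetCat X) : ∃ e : X → X, (∀ x, e x ∈ A.set) ∧
    (∀ x ∈ A.set, e x = x) ∧ Setoid.ker e ≠ ⊥ := by
  obtain ⟨e, he, he'⟩ := A.exists_retraction
  refine ⟨e, he, he', fun h => A.ne_univ (Set.eq_univ_iff_forall.2 fun x => ?_)⟩
  have : Setoid.ker e (e x) x := he' _ (he x)
  rw [h] at this
  have e1 : e x = x := this
  exact e1 ▸ he x

theorem sigmaCone_injective (A : PowersetCat X) (π : PartitionCat X) :
    Function.Injective (sigmaCone : transSet A π → _) := by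
  intro a b h
  obtain ⟨e, he, he', hk⟩ := A.exists_separating
  have key : ∀ (γ δ : SubCone (PartitionCat X)), γ = δ → ∀ x, γ.app ⟨Setoid.ker e, hk⟩
      (Quotient.mk _ x) = δ.app ⟨Setoid.ker e, hk⟩ (Quotient.mk _ x) := by
    rintro γ _ rfl x
    rfl
  refine Subtype.ext (funext fun x => ?_)
  have h1 : Quotient.mk (Setoid.ker e) (a.1 x) = Quotient.mk (Setoid.ker e) (b.1 x) := key _ _ h x
  have h2 : e (a.1 x) = e (b.1 x) := Quotient.exact h1
  rwa [he' _ (a.2.2.1 ⟨x, rfl⟩), he' _ (b.2.2.1 ⟨x, rfl⟩)] at h2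

theorem rho_star_epi [Nonempty X] (a : X → X) (h : Set.range a ≠ Set.univ) {B : PowersetCat X}
    (f : imageObj a h ⟶ B) (h' : Set.range (fun x => (f ⟨a x, x, rfl⟩).1) ≠ Set.univ) :
    (rho a h).star (epi f) = rho (fun x => (f ⟨a x, x, rfl⟩).1) h' := by
  let q : imageObj a h ⟶ imageObj _ h' := fun y => ⟨(f y).1, by
    obtain ⟨_, x, rfl⟩ := y
    exact ⟨x, rfl⟩⟩
  have hq : Function.Surjective (q : (imageObj a h).set → (imageObj _ h').set) := by
    rintro ⟨_, x, rfl⟩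
    exact ⟨⟨a x, x, rfl⟩, rfl⟩
  exact (rho a h).star_epi f (m := imageObj _ h')
    (by rintro _ ⟨x, rfl⟩; exact Subtype.property _) q (Function.surjInv hq)
    (funext fun y => Function.surjInv_eq hq y) rfl

/-- The injective map on the blocks of `π_a` induced by `a`. -/
def kerMap (a : X → X) : Quotient (Setoid.ker a) → X :=
  Quotient.lift (s := Setoid.ker a) a fun _ _ h => h

theorem kerMap_injective (a : X → X) : Function.Injective (kerMap a) := by
  intro x y
  induction x using Quotient.inductionOn
  induction y using Quotient.inductionOn
  exact fun h => Quotient.sound h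

theorem sigma_star_epi (a : X → X) (h : Setoid.ker a ≠ ⊥) {π : PartitionCat X}
    (f : (sigma a h).vertex ⟶ π)
    (h' : Setoid.ker (fun x => kerMap a (f (Quotient.mk _ x))) ≠ ⊥) :
    (sigma a h).star (epi f) = sigma (fun x => kerMap a (f (Quotient.mk _ x))) h' := by
  let b : X → X := fun x => kerMap a (f (Quotient.mk _ x))
  let m : PartitionCat X := ⟨Setoid.ker b, h'⟩
  have hm : Sub m π := fun {x y} hxy => congrArg (fun t => kerMap a (f t))
    (Quotient.sound hxy : Quotient.mk π.rel x = Quotient.mk π.rel y)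
  let q : Quotient (Setoid.ker b) → Quotient (Setoid.ker a) :=
    Quotient.lift (s := Setoid.ker b) (fun x => f (Quotient.mk _ x))
      fun _ _ hxy => kerMap_injective a hxy
  have hq : Function.Injective q := by
    intro x y
    induction x using Quotient.inductionOn
    induction y using Quotient.inductionOn
    exact fun h => Quotient.sound (congrArg (kerMap a) h)
  have : Nonempty (Quotient (Setoid.ker b)) := m.nonempty_quotient
  rw [(sigma a h).star_epi f (m := m) hm q (Function.invFun q)
    (funext fun y => Function.leftInverse_invFun hq y)
    (funext fun y => Quotient.inductionOn y fun _ => rfl)]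
  have key : ∀ α : PartitionCat X,
      CategoryStruct.comp (Y := (sigma a h).vertex) (Z := m) ((sigma a h).app α) q =
        (sigma b h').app α := by
    intro α
    funext y
    induction y using Quotient.inductionOn with
    | h x =>
      change (sigma a h).app α (f (Quotient.mk _ x)) =
        Quotient.mk _ (kerMap a (f (Quotient.mk _ x)))
      exact Quotient.inductionOn (f (Quotient.mk _ x)) fun _ => rfl
  exact SubCone.star_eq (sigma a h) (sigma b h') q key

end CrossConn

namespace CrossConn
open SubobjectCategory

variable {X : Type u}

/-! ### The normal duals of the two categories -/

/-- The `H`-functor of the powerset category that corresponds to a partition `π`: it is `H(ρ^e;-)`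
for every idempotent transformation `e` with `π_e = π`, and its value at `A` consists of the cones
`ρ^a` with `Im a ⊆ A` and `π̄_a ⊆ π̄`. -/
def powersetDual [Nontrivial X] (π : PartitionCat X) : NormalDual (PowersetCat X) where
  sets A := Set.range (rhoCone : transSet A π → _)
  exists_cone := by
    obtain ⟨e, he, he'⟩ := π.exists_idempotent
    have hr : Set.range e ≠ Set.univ := fun h => π.ne_bot (le_bot_iff.1 fun {x y} hxy => by
      have hid : ∀ x, e x = x := fun x => by
        obtain ⟨z, rfl⟩ := (h.symm ▸ Set.mem_univ x : x ∈ Set.range e)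
        exact he' z
      have h2 : e x = e y := he.ge hxy
      rwa [hid, hid] at h2)
    refine ⟨rho e hr, SubCone.isIdempotentNormal_of_app _ ?_, fun A => ?_⟩
    · funext y
      obtain ⟨_, x, rfl⟩ := y
      exact Subtype.ext (he' x)
    · apply Set.Subset.antisymm
      · rintro _ ⟨a, rfl⟩
        refine ⟨fun y => ⟨a.1 y.1, a.2.2.1 ⟨_, rfl⟩⟩, ?_⟩
        have hae : (fun x => a.1 (e x)) = a.1 := funext fun x =>
          a.2.2.2 (he.le (he' x : Setoid.ker e (e x) x))
        refine Eq.trans ?_ (rho_star_epi e hr (B := A) _ ?_).symm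
        · change rho a.1 _ = rho (fun x => a.1 (e x)) _
          simp only [hae]
        · change Set.range (fun x => a.1 (e x)) ≠ Set.univ
          rw [hae]
          exact range_ne_univ a
      · rintro _ ⟨f, rfl⟩
        have hm : (fun x => (f ⟨e x, x, rfl⟩).1) ∈ transSet A π :=
          mem_transSet (fun _ => Subtype.property _) fun {x y} hxy => by
            have h2 : e x = e y := he.ge hxy
            change (f ⟨e x, x, rfl⟩).1 = (f ⟨e y, y, rfl⟩).1
            simp only [h2]
        exact ⟨⟨_, hm⟩, (rho_star_epi e hr (B := A) f (range_ne_univ ⟨_, hm⟩)).symm⟩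

/-- The `H`-functor of the category of partitions that corresponds to a subset `A`: it is
`H(σ^e;-)` for every idempotent transformation `e` with `Im e = A`, and its value at `π̄` consists of
the cones `σ^a` with `Im a ⊆ A` and `π̄_a ⊆ π̄`. -/
def partitionDual (A : PowersetCat X) : NormalDual (PartitionCat X) where
  sets π := Set.range (sigmaCone : transSet A π → _)
  exists_cone := by
    obtain ⟨e, he, he', hk⟩ := A.exists_separating
    have hmap : ∀ y, kerMap e y ∈ A.set := fun y => Quotient.inductionOn y fun x => he x
    have hmk : ∀ y, Quotient.mk (Setoid.ker e) (kerMap e y) = y := fun y =>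
      Quotient.inductionOn y fun x => Quotient.sound (he' _ (he x))
    refine ⟨sigma e hk, SubCone.isIdempotentNormal_of_app _ ?_, fun π => ?_⟩
    · funext y
      exact Quotient.inductionOn y fun x => Quotient.sound (he' _ (he x))
    · apply Set.Subset.antisymm
      · rintro _ ⟨a, rfl⟩
        have hae : (fun x => kerMap e (Quotient.mk (Setoid.ker e) (a.1 x))) = a.1 :=
          funext fun x => he' _ (a.2.2.1 ⟨x, rfl⟩)
        refine ⟨fun y => Quotient.mk (Setoid.ker e) (descend a y).1, ?_⟩
        refine Eq.trans ?_ (sigma_star_epi e hk (π := π) _ ?_).symm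
        · change sigma a.1 _ = sigma (fun x => kerMap e (Quotient.mk (Setoid.ker e) (a.1 x))) _
          simp only [hae]
        · change Setoid.ker (fun x => kerMap e (Quotient.mk (Setoid.ker e) (a.1 x))) ≠ ⊥
          rw [hae]
          exact ker_ne_bot a
      · rintro _ ⟨f, rfl⟩
        have hm : (fun x => kerMap e (f (Quotient.mk _ x))) ∈ transSet A π :=
          mem_transSet (fun _ => hmap _) fun {x y} hxy =>
            congrArg (fun t => kerMap e (f t))
              (Quotient.sound hxy : Quotient.mk π.rel x = Quotient.mk π.rel y)
        exact ⟨⟨_, hm⟩, (sigma_star_epi e hk f (ker_ne_bot ⟨_, hm⟩)).symm⟩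

theorem rhoCone_act [Nontrivial X] {A B : PowersetCat X} {π : PartitionCat X} (a : transSet A π)
    (f : A ⟶ B) (h : Sub (rhoCone a).vertex A) :
    (rhoCone a).act h f = rhoCone (transMap f (𝟙 π) a) :=
  rho_star_epi a.1 (range_ne_univ a) (incl h ≫ f) (range_ne_univ (transMap f (𝟙 π) a))

theorem sigmaCone_act {A : PowersetCat X} {π π' : PartitionCat X} (a : transSet A π)
    (u : π ⟶ π') (h : Sub (sigmaCone a).vertex π) :
    (sigmaCone a).act h u = sigmaCone (transMap (𝟙 A) u a) := by
  have e : (fun x => kerMap a.1 ((incl h ≫ u) (Quotient.mk π'.rel x))) =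
      (transMap (𝟙 A) u a).1 := by
    funext x
    change kerMap a.1 (PartitionCat.coarsen h (u (Quotient.mk _ x))) =
      (descend a (u (Quotient.mk _ x))).1
    exact Quotient.inductionOn (u (Quotient.mk _ x)) fun _ => rfl
  have h' := ker_ne_bot (transMap (𝟙 A) u a)
  rw [← e] at h'
  refine (sigma_star_epi a.1 (ker_ne_bot a) (incl h ≫ u) h').trans ?_
  simp only [sigmaCone]
  congr 1

/-- The element `ρ^a` of `H(ρ^e;A)`, as a bijection from `{a : Im a ⊆ A, π̄_a ⊆ π̄}`. -/
noncomputable def rhoEquiv [Nontrivial X] (A : PowersetCat X) (π : PartitionCat X) :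
    transSet A π ≃ (powersetDual π).sets A :=
  Equiv.ofInjective _ (rhoCone_injective A π)

/-- The element `σ^a` of `H(σ^e;π̄)`, as a bijection from `{a : Im a ⊆ A, π̄_a ⊆ π̄}`. -/
noncomputable def sigmaEquiv (A : PowersetCat X) (π : PartitionCat X) :
    transSet A π ≃ (partitionDual A).sets π :=
  Equiv.ofInjective _ (sigmaCone_injective A π)

theorem transMap_id {A : PowersetCat X} {π : PartitionCat X} (a : transSet A π) :
    transMap (𝟙 A) (𝟙 π) a = a := rfl

theorem transMap_comp {A B D : PowersetCat X} {π π' π'' : PartitionCat X} (f : A ⟶ B) (g : B ⟶ D)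
    (u : π ⟶ π') (v : π' ⟶ π'') (a : transSet A π) :
    transMap (f ≫ g) (u ≫ v) a = transMap g v (transMap f u a) :=
  Subtype.ext (funext fun _ => (congrArg (fun t => (g t).1) (descend_transMap f u a _)).symm)

/-- The functor `Q : Π(X) ⥤ N*𝒫(X)` identifying the category of partitions with the normal dual of
the powerset category: `π̄ ↦ H(ρ^e;-)` with `π_e = π`, and `η*` goes to the natural transformation
`ρ^a ↦ ρ^{η a}`. -/
noncomputable def toPowersetDual (X : Type u) [Nontrivial X] :
    PartitionCat X ⥤ NormalDual (PowersetCat X) where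
  obj π := powersetDual π
  map {π π'} η :=
    show (powersetDual π).toFunctor ⟶ (powersetDual π').toFunctor from
    { app := fun A => TypeCat.ofHom fun x =>
        rhoEquiv A π' (transMap (𝟙 A) η ((rhoEquiv A π).symm x))
      naturality := fun A B f => by
        ext x
        obtain ⟨a, rfl⟩ := (rhoEquiv A π).surjective x
        have h1 : ∀ (σ : PartitionCat X) (b : transSet A σ),
            (powersetDual σ).toFunctor.map f (rhoEquiv A σ b) =
              rhoEquiv B σ (transMap f (𝟙 σ) b) :=
          fun σ b => Subtype.ext (rhoCone_act b f _)
        change rhoEquiv B π' (transMap (𝟙 B) η ((rhoEquiv B π).symm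
          ((powersetDual π).toFunctor.map f (rhoEquiv A π a)))) =
          (powersetDual π').toFunctor.map f
            (rhoEquiv A π' (transMap (𝟙 A) η ((rhoEquiv A π).symm (rhoEquiv A π a))))
        rw [h1, h1, Equiv.symm_apply_apply, Equiv.symm_apply_apply, ← transMap_comp,
          ← transMap_comp]
        rfl }
  map_id π := by
    apply NatTrans.ext
    funext A
    ext x
    exact (rhoEquiv A π).apply_symm_apply x
  map_comp {π π' π''} η μ := by
    apply NatTrans.ext
    funext A
    ext x
    change rhoEquiv A π'' (transMap (𝟙 A) (η ≫ μ) ((rhoEquiv A π).symm x)) =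
      rhoEquiv A π'' (transMap (𝟙 A) μ ((rhoEquiv A π').symm
        (rhoEquiv A π' (transMap (𝟙 A) η ((rhoEquiv A π).symm x)))))
    rw [Equiv.symm_apply_apply, ← transMap_comp]
    rfl

/-- The functor `𝒫(X) ⥤ N*Π(X)` identifying subsets with `H`-functors of the category of
partitions: `A ↦ H(σ^e;-)` with `Im e = A`, and `f` goes to the natural transformation
`σ^a ↦ σ^{a f}`. -/
noncomputable def toPartitionDual (X : Type u) : PowersetCat X ⥤ NormalDual (PartitionCat X) where
  obj A := partitionDual A
  map {A B} f :=
    show (partitionDual A).toFunctor ⟶ (partitionDual B).toFunctor from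
    { app := fun π => TypeCat.ofHom fun x =>
        sigmaEquiv B π (transMap f (𝟙 π) ((sigmaEquiv A π).symm x))
      naturality := fun π π' u => by
        ext x
        obtain ⟨a, rfl⟩ := (sigmaEquiv A π).surjective x
        have h1 : ∀ (S : PowersetCat X) (b : transSet S π),
            (partitionDual S).toFunctor.map u (sigmaEquiv S π b) =
              sigmaEquiv S π' (transMap (𝟙 S) u b) :=
          fun S b => Subtype.ext (sigmaCone_act b u _)
        change sigmaEquiv B π' (transMap f (𝟙 π') ((sigmaEquiv A π').symm
          ((partitionDual A).toFunctor.map u (sigmaEquiv A π a)))) =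
          (partitionDual B).toFunctor.map u
            (sigmaEquiv B π (transMap f (𝟙 π) ((sigmaEquiv A π).symm (sigmaEquiv A π a))))
        rw [h1, h1, Equiv.symm_apply_apply, Equiv.symm_apply_apply, ← transMap_comp,
          ← transMap_comp]
        rfl }
  map_id A := by
    apply NatTrans.ext
    funext π
    ext x
    exact (sigmaEquiv A π).apply_symm_apply x
  map_comp {A B D} f g := by
    apply NatTrans.ext
    funext π
    ext x
    change sigmaEquiv D π (transMap (f ≫ g) (𝟙 π) ((sigmaEquiv A π).symm x)) =
      sigmaEquiv D π (transMap g (𝟙 π) ((sigmaEquiv B π).symm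
        (sigmaEquiv B π (transMap f (𝟙 π) ((sigmaEquiv A π).symm x)))))
    rw [Equiv.symm_apply_apply, ← transMap_comp]
    rfl

/-- `Γ_θ`, as a functor from `Π(X)` to the normal dual of `𝒫(X)`. -/
noncomputable def gammaPerm [Nontrivial X] (θ : Equiv.Perm X) :
    PartitionCat X ⥤ NormalDual (PowersetCat X) :=
  partitionPerm θ ⋙ toPowersetDual X

/-- `Δ_θ`, as a functor from `𝒫(X)` to the normal dual of `Π(X)`. -/
noncomputable def deltaPerm (θ : Equiv.Perm X) : PowersetCat X ⥤ NormalDual (PartitionCat X) :=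
  powersetPerm θ ⋙ toPartitionDual X

/-- The identification `a ↦ ρ^a` of the elements of `Γ(A,π̄)`, for `Γ : Π(X) ⥤ Π(X)`, with the
elements of the bifunctor of `Γ` as a functor to the normal dual of `𝒫(X)`. -/
noncomputable def gammaCone [Nontrivial X] (Γ : PartitionCat X ⥤ PartitionCat X) :
    gammaBifunctor Γ ≅ bifunctorLeft (Γ ⋙ toPowersetDual X) :=
  NatIso.ofComponents (fun P => (rhoEquiv P.1 (Γ.obj P.2)).toIso) fun {P P'} g => by
    ext a
    change transSet P.1 (Γ.obj P.2) at a
    have h1 : ∀ b : transSet P.1 (Γ.obj P'.2),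
        (powersetDual (Γ.obj P'.2)).toFunctor.map g.1 (rhoEquiv P.1 (Γ.obj P'.2) b) =
          rhoEquiv P'.1 (Γ.obj P'.2) (transMap g.1 (𝟙 _) b) :=
      fun b => Subtype.ext (rhoCone_act b g.1 _)
    change rhoEquiv P'.1 (Γ.obj P'.2) (transMap g.1 (Γ.map g.2) a) =
      (powersetDual (Γ.obj P'.2)).toFunctor.map g.1 (rhoEquiv P.1 (Γ.obj P'.2)
        (transMap (𝟙 _) (Γ.map g.2) ((rhoEquiv P.1 (Γ.obj P.2)).symm
          (rhoEquiv P.1 (Γ.obj P.2) a))))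
    rw [h1, Equiv.symm_apply_apply, ← transMap_comp]
    rfl

/-- The identification `a ↦ σ^a` of the elements of `Δ(A,π̄)`, for `Δ : 𝒫(X) ⥤ 𝒫(X)`, with the
elements of the bifunctor of `Δ` as a functor to the normal dual of `Π(X)`. -/
noncomputable def deltaCone (Δ : PowersetCat X ⥤ PowersetCat X) :
    deltaBifunctor Δ ≅ bifunctorRight (Δ ⋙ toPartitionDual X) :=
  NatIso.ofComponents (fun P => (sigmaEquiv (Δ.obj P.1) P.2).toIso) fun {P P'} g => by
    ext a
    change transSet (Δ.obj P.1) P.2 at a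
    have h1 : ∀ b : transSet (Δ.obj P'.1) P.2,
        (partitionDual (Δ.obj P'.1)).toFunctor.map g.2 (sigmaEquiv (Δ.obj P'.1) P.2 b) =
          sigmaEquiv (Δ.obj P'.1) P'.2 (transMap (𝟙 _) g.2 b) :=
      fun b => Subtype.ext (sigmaCone_act b g.2 _)
    change sigmaEquiv (Δ.obj P'.1) P'.2 (transMap (Δ.map g.1) g.2 a) =
      (partitionDual (Δ.obj P'.1)).toFunctor.map g.2 (sigmaEquiv (Δ.obj P'.1) P.2
        (transMap (Δ.map g.1) (𝟙 _) ((sigmaEquiv (Δ.obj P.1) P.2).symm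
          (sigmaEquiv (Δ.obj P.1) P.2 a))))
    rw [h1, Equiv.symm_apply_apply, ← transMap_comp]
    rfl

/-- The identifications of the two descriptions of the bifunctors act by `a ↦ ρ^a`, `a ↦ σ^a`. -/
theorem coneLeft_gammaCone [Nontrivial X] (Γ : PartitionCat X ⥤ PartitionCat X)
    (A : PowersetCat X) (π : PartitionCat X) (a : (gammaBifunctor Γ).obj (A, π)) :
    coneLeft ((gammaCone Γ).hom.app (A, π) a) =
      rhoCone (A := A) (π := Γ.obj π) a := rfl

theorem coneRight_deltaCone (Δ : PowersetCat X ⥤ PowersetCat X)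
    (A : PowersetCat X) (π : PartitionCat X) (a : (deltaBifunctor Δ).obj (A, π)) :
    coneRight ((deltaCone Δ).hom.app (A, π) a) =
      sigmaCone (A := Δ.obj A) (π := π) a := rfl

end CrossConn

open CrossConn

namespace CrossConn
open SubobjectCategory

/-! ### Idempotent cones, generators of `H`-functors, and composites of local isomorphisms -/

section General

variable {C : Type u} [SmallCategory C] [NormalCategory C]

/-! Existence. The cones in both normal duals are encoded by transformations, as `ρ^a` or `σ^a`. The
generators of the `H`-functors of `π` and of `A` are the cones of projections, that is, of
idempotents with prescribed image and kernel (`exists_isProjection_of_powersetDual`,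
`exists_isProjection_of_partitionDual`). Accordingly, `A` and `π` are related by the `M`-sets
exactly when there is a projection onto `A` along `π`. Every transformation constant on the blocks
of `π` factors through a projection along `π`, and every one with values in `A` through a projection
onto `A`. So a natural transformation is determined by one value, as in Yoneda's lemma, and this
makes the two identifications with the normal duals local isomorphisms. Conjugation by `θ` carries
projections onto `A` along `θ⁻¹(π)` to projections onto `θ(A)` along `π` (`IsProjection.conj`,
`IsProjection.conj_symm`). This gives the `M`-set condition and the condition on idempotent cones;
naturality is a cancellation of `θ θ⁻¹` (`conjEquiv_transMap`).

Uniqueness. Let `χ'` be a duality from `Γ_θ` to any `Δ`, and consider the image of `ρ^a` under it.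
Since `Δ` preserves inclusions, naturality allows a comparison with constant maps: the component of
this image on the block of `z` depends only on the point `y` to which `θ⁻¹ a` sends `z`
(`imageCone_app_congr`). For a given `β`, the point `y` is also a value of a projection along
`θ⁻¹(β)`. Its cone must go to an idempotent cone with vertex `β`, whose component at `β` is the
identity. This forces the component at `β` of the image of `ρ^a` to send the block of `z` to the
block of `θ(y)` (`IsDuality.imageCone_app`). The vertex is found by factoring `a` through a
projection onto `A`, so the image is `σ^{θ⁻¹ a θ}` (`IsDuality.imageCone_eq`). Both `χ'` and `Δ` can
be read off from this. -/

theorem SubCone.mem_hset_vertex (γ : SubCone C) : γ ∈ γ.hset γ.vertex := by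
  refine ⟨𝟙 _, ?_⟩
  rw [γ.star_epi (𝟙 _) (sub_refl _) (𝟙 _) (𝟙 _) (by simp) (by rw [incl_refl]; simp)]
  simp [SubCone.star]

/-- The component of an idempotent normal cone at its vertex is the identity. -/
theorem SubCone.IsIdempotentNormal.app_vertex {γ : SubCone C} (h : γ.IsIdempotentNormal) :
    γ.app γ.vertex = 𝟙 _ := by
  obtain ⟨⟨c, hc⟩, hm⟩ := h
  have hv : im (γ.app γ.vertex) = γ.vertex := congrArg SubCone.vertex hm
  have key : ∀ (δ : SubCone C) (e : δ.vertex = γ.vertex), δ = γ → ∀ c,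
      δ.app c ≫ eqToHom e = γ.app c := by
    rintro δ e rfl c
    simp
  have h1 := key _ hv hm c
  have h2 : γ.app c ≫ epi (γ.app γ.vertex) ≫ eqToHom hv = γ.app c ≫ 𝟙 _ := by
    rw [Category.comp_id]
    refine Eq.trans ?_ h1
    exact (Category.assoc _ _ _).symm
  -- Normality enters here: the component at `c` is an isomorphism, so it can be cancelled.
  rw [cancel_epi] at h2
  have h3 := epi_incl (γ.app γ.vertex)
  have h4 : ∀ (m : C) (e : m = γ.vertex) (k : Sub m γ.vertex), incl k = eqToHom e := by
    rintro m rfl k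
    exact incl_refl _
  rw [h4 _ hv] at h3
  exact h3.symm.trans h2

theorem NormalDual.IsGeneratedBy.mem {F : NormalDual C} {ε : SubCone C} (h : F.IsGeneratedBy ε) :
    ε ∈ F.sets ε.vertex := by
  rw [h.2]
  exact ε.mem_hset_vertex

end General

theorem IsLocalIso.comp {C D E : Type u} [SmallCategory C] [SmallCategory D] [SmallCategory E]
    [SubobjectCategory C] [SubobjectCategory D] [SubobjectCategory E] {F : C ⥤ D} {G : D ⥤ E}
    (hF : IsLocalIso F) (hG : IsLocalIso G) : IsLocalIso (F ⋙ G) where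
  map_sub h := by
    obtain ⟨k, hk⟩ := hF.map_sub h
    obtain ⟨l, hl⟩ := hG.map_sub k
    exact ⟨l, by rw [Functor.comp_map, hk, hl]⟩
  full := by
    have := hF.full
    have := hG.full
    infer_instance
  faithful := by
    have := hF.faithful
    have := hG.faithful
    infer_instance
  ideal c := (hG.ideal (F.obj c)).comp (hF.ideal c)

variable {X : Type u}

theorem PowersetCat.bijective_of_isIso {A B : PowersetCat X} (f : A ⟶ B) [IsIso f] :
    Function.Bijective (f : A.set → B.set) :=
  Function.bijective_iff_has_inverse.2 ⟨inv f, fun x => congrFun (IsIso.hom_inv_id f) x,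
    fun x => congrFun (IsIso.inv_hom_id f) x⟩

theorem PartitionCat.bijective_of_isIso {π₁ π₂ : PartitionCat X} (f : π₁ ⟶ π₂) [IsIso f] :
    Function.Bijective (f : Quotient π₂.rel → Quotient π₁.rel) :=
  Function.bijective_iff_has_inverse.2 ⟨inv f, fun x => congrFun (IsIso.inv_hom_id f) x,
    fun x => congrFun (IsIso.hom_inv_id f) x⟩

/-! ### Projections -/

/-- The transformation `e` is the projection onto `A` along `π`: the idempotent transformation with
image `A` and kernel `π`. -/
structure IsProjection (e : X → X) (A : PowersetCat X) (π : PartitionCat X) : Prop where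
  range_eq : Set.range e = A.set
  ker_eq : Setoid.ker e = π.rel
  idem : ∀ x, e (e x) = e x

namespace IsProjection

variable {e : X → X} {A : PowersetCat X} {π : PartitionCat X}

theorem mem (h : IsProjection e A π) : e ∈ transSet A π :=
  mem_transSet (fun x => h.range_eq ▸ ⟨x, rfl⟩) h.ker_eq.ge

theorem apply_of_mem (h : IsProjection e A π) {x : X} (hx : x ∈ A.set) : e x = x := by
  rw [← h.range_eq] at hx
  obtain ⟨y, rfl⟩ := hx
  exact h.idem y

theorem rel_apply (h : IsProjection e A π) (x : X) : π.rel (e x) x :=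
  h.ker_eq ▸ (h.idem x : Setoid.ker e (e x) x)

end IsProjection

/-- Every subset is the image of a projection. -/
theorem PowersetCat.exists_isProjection (A : PowersetCat X) : ∃ e π, IsProjection e A π := by
  obtain ⟨e, he, he', hk⟩ := A.exists_separating
  refine ⟨e, ⟨_, hk⟩, Set.Subset.antisymm ?_ fun x hx => ⟨x, he' x hx⟩, rfl,
    fun x => he' _ (he x)⟩
  rintro _ ⟨x, rfl⟩
  exact he x

/-- A partition is the kernel of a projection whose image contains any given point. -/
theorem PartitionCat.exists_isProjection (π : PartitionCat X) (y : X) :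
    ∃ e A, IsProjection e A π ∧ y ∈ A.set := by
  classical
  -- A choice of representatives, altered so that `y` represents its own block; this puts `y` into
  -- the image.
  let s : Quotient π.rel → X := fun q => if q = Quotient.mk _ y then y else q.out
  have hs : ∀ q, Quotient.mk π.rel (s q) = q := by
    intro q
    by_cases hq : q = Quotient.mk _ y
    · subst hq
      exact congrArg (Quotient.mk _) (if_pos rfl)
    · simp only [s, if_neg hq]
      exact q.out_eq
  have hk : ∀ x z, s (Quotient.mk _ x) = s (Quotient.mk _ z) ↔ π.rel x z := fun x z =>
    ⟨fun h => Quotient.exact (by rw [← hs (Quotient.mk _ x), h, hs]), fun h =>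
      congrArg s (Quotient.sound h)⟩
  refine ⟨fun x => s (Quotient.mk _ x), ⟨Set.range fun x => s (Quotient.mk _ x), ⟨_, y, rfl⟩, ?_⟩,
    ⟨rfl, Setoid.ext hk, fun x => by simp only [hs]⟩, y, if_pos rfl⟩
  -- A surjective idempotent is the identity, and its kernel would be the partition into singletons.
  intro h
  refine π.ne_bot (le_bot_iff.1 fun {x z} hxz => ?_)
  have hid : ∀ x, s (Quotient.mk _ x) = x := fun x => by
    obtain ⟨w, rfl⟩ := (h.symm ▸ Set.mem_univ x : x ∈ Set.range fun x => s (Quotient.mk _ x))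
    simp only [hs]
  exact ((hid x).symm.trans ((hk x z).2 hxz)).trans (hid z)

/-! ### The cones that generate the `H`-functors -/

/-- The component at the singleton `{x}`, a proper subset because `X` is nontrivial, recovers the
value at `x`. Unlike in `rhoCone_injective`, no common `A` and `π` are required. -/
theorem rho_injective [Nontrivial X] {a b : X → X} {ha : Set.range a ≠ Set.univ}
    {hb : Set.range b ≠ Set.univ} (h : rho a ha = rho b hb) : a = b := by
  funext x
  obtain ⟨y, hy⟩ := exists_ne x
  let S : PowersetCat X := ⟨{x}, ⟨x, rfl⟩, fun e => hy (e.symm ▸ Set.mem_univ y : y ∈ ({x} : Set X))⟩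
  exact congrArg (fun γ : SubCone (PowersetCat X) => (γ.app S ⟨x, rfl⟩).1) h

/-- A transformation constant on the fibres of `a` is a composite `a f` with `f` defined on `Im a`,
so the `H`-functor of `ρ^a` depends only on the kernel of `a`. Idempotency of `a` is not required,
so the lemma applies to cones of which only membership in some `H`-functor is known. -/
theorem powersetDual_sets [Nontrivial X] (a : X → X) (h : Set.range a ≠ Set.univ)
    {π : PartitionCat X} (hπ : Setoid.ker a = π.rel) (A : PowersetCat X) :
    (powersetDual π).sets A = (rho a h).hset A := by
  apply Set.Subset.antisymm
  · rintro _ ⟨b, rfl⟩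
    have hb : Setoid.ker a ≤ Setoid.ker b.1 := hπ.le.trans b.2.2.2
    -- A point of `Im a` is lifted along `a` and then mapped by `b`; the choice of the lift does not
    -- matter, since `b` is constant on the fibres of `a`.
    refine ⟨fun y => ⟨b.1 y.2.choose, b.2.2.1 ⟨_, rfl⟩⟩, ?_⟩
    have hab : (fun x => b.1 (⟨x, rfl⟩ : ∃ y, a y = a x).choose) = b.1 := funext fun x =>
      hb (⟨x, rfl⟩ : ∃ y, a y = a x).choose_spec
    refine Eq.trans ?_ (rho_star_epi a h (B := A) _ ?_).symm
    · change rho b.1 _ = rho (fun x => b.1 (⟨x, rfl⟩ : ∃ y, a y = a x).choose) _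
      simp only [hab]
    · change Set.range (fun x => b.1 (⟨x, rfl⟩ : ∃ y, a y = a x).choose) ≠ Set.univ
      rw [hab]
      exact range_ne_univ b
  · rintro _ ⟨f, rfl⟩
    have hm : (fun x => (f ⟨a x, x, rfl⟩).1) ∈ transSet A π :=
      mem_transSet (fun _ => Subtype.property _) fun {x y} hxy => by
        have h2 : a x = a y := hπ.ge hxy
        change (f ⟨a x, x, rfl⟩).1 = (f ⟨a y, y, rfl⟩).1
        simp only [h2]
    exact ⟨⟨_, hm⟩, (rho_star_epi a h (B := A) f (range_ne_univ ⟨_, hm⟩)).symm⟩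

/-- Dually, a transformation with values in `Im a` factors on the left through the blocks of `π_a`,
since these blocks correspond to the points of `Im a`. -/
theorem partitionDual_sets (a : X → X) (h : Setoid.ker a ≠ ⊥)
    {A : PowersetCat X} (hA : Set.range a = A.set) (π : PartitionCat X) :
    (partitionDual A).sets π = (sigma a h).hset π := by
  have hmap : ∀ y, kerMap a y ∈ A.set := fun y => Quotient.inductionOn y fun x => hA ▸ ⟨x, rfl⟩
  apply Set.Subset.antisymm
  · rintro _ ⟨b, rfl⟩
    have hb : ∀ x, ∃ y, a y = b.1 x := fun x => (hA.symm ▸ b.2.2.1 ⟨x, rfl⟩ : b.1 x ∈ Set.range a)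
    let f : Quotient π.rel → Quotient (Setoid.ker a) :=
      Quotient.lift (s := π.rel) (fun x => Quotient.mk _ (hb x).choose) fun x y hxy =>
        Quotient.sound (((hb x).choose_spec.trans (b.2.2.2 hxy)).trans (hb y).choose_spec.symm)
    have hf : (fun x => kerMap a (f (Quotient.mk _ x))) = b.1 := funext fun x =>
      (hb x).choose_spec
    have h' := ker_ne_bot b
    refine ⟨f, ?_⟩
    rw [← hf] at h'
    refine Eq.trans ?_ (sigma_star_epi a h (π := π) f h').symm
    change sigma b.1 _ = _
    simp only [hf]
  · rintro _ ⟨f, rfl⟩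
    have hm : (fun x => kerMap a (f (Quotient.mk _ x))) ∈ transSet A π :=
      mem_transSet (fun _ => hmap _) fun {x y} hxy =>
        congrArg (fun t => kerMap a (f t))
          (Quotient.sound hxy : Quotient.mk π.rel x = Quotient.mk π.rel y)
    exact ⟨⟨_, hm⟩, (sigma_star_epi a h f (ker_ne_bot ⟨_, hm⟩)).symm⟩

theorem imageObj_eq [Nonempty X] {a : X → X} (h : Set.range a ≠ Set.univ) {A : PowersetCat X}
    (hA : Set.range a = A.set) : imageObj a h = A :=
  PowersetCat.ext hA

theorem IsProjection.powersetDual_isGeneratedBy [Nontrivial X] {e : X → X} {A : PowersetCat X}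
    {π : PartitionCat X} (he : IsProjection e A π) (h : Set.range e ≠ Set.univ) :
    (powersetDual π).IsGeneratedBy (rho e h) := by
  refine ⟨SubCone.isIdempotentNormal_of_app _ ?_, powersetDual_sets e h he.ker_eq⟩
  funext y
  obtain ⟨_, x, rfl⟩ := y
  exact Subtype.ext (he.idem x)

theorem IsProjection.partitionDual_isGeneratedBy {e : X → X} {A : PowersetCat X}
    {π : PartitionCat X} (he : IsProjection e A π) (h : Setoid.ker e ≠ ⊥) :
    (partitionDual A).IsGeneratedBy (sigma e h) := by
  refine ⟨SubCone.isIdempotentNormal_of_app _ ?_, partitionDual_sets e h he.range_eq⟩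
  funext y
  exact Quotient.inductionOn y fun x => Quotient.sound (he.idem x)

/-- A generator belongs to its own functor, hence is some `ρ^a` with `a` constant on the blocks of
`π`. Conversely, the cone of a projection along `π` lies in `H(ρ^a;-)`, so the kernel of `a` is no
coarser than `π`. Idempotency of `a` is the identity component at the vertex. -/
theorem exists_isProjection_of_powersetDual [Nontrivial X] {π : PartitionCat X}
    {ε : SubCone (PowersetCat X)} (h : (powersetDual π).IsGeneratedBy ε) :
    ∃ a hr, ε = rho a hr ∧ IsProjection a ε.vertex π := by
  obtain ⟨_, a, rfl⟩ : ∃ B, ε ∈ NormalDual.sets _ B := ⟨_, h.mem⟩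
  refine ⟨a.1, range_ne_univ a, rfl, rfl, le_antisymm ?_ a.2.2.2, fun x => ?_⟩
  · obtain ⟨e, B, he, -⟩ := π.exists_isProjection (Classical.arbitrary X)
    have h1 : rhoCone ⟨e, he.mem⟩ ∈ (powersetDual π).sets B := ⟨_, rfl⟩
    rw [h.2] at h1
    change _ ∈ (rho a.1 (range_ne_univ a)).hset B at h1
    have h2 := (powersetDual_sets a.1 (range_ne_univ a) (π := ⟨_, ker_ne_bot a⟩) rfl B).ge h1
    obtain ⟨b, hb⟩ := h2
    have h3 : b.1 = e := rho_injective hb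
    have h4 := b.2.2.2
    rw [h3, he.ker_eq] at h4
    exact h4
  · have h1 := h.1.app_vertex
    exact congrArg (fun t : (rhoCone a).vertex ⟶ (rhoCone a).vertex => (t ⟨a.1 x, x, rfl⟩).1) h1

theorem exists_isProjection_of_partitionDual {A : PowersetCat X}
    {ε : SubCone (PartitionCat X)} (h : (partitionDual A).IsGeneratedBy ε) :
    ∃ a hk, ε = sigma a hk ∧ IsProjection a A ε.vertex := by
  obtain ⟨_, a, rfl⟩ : ∃ B, ε ∈ NormalDual.sets _ B := ⟨_, h.mem⟩
  refine ⟨a.1, ker_ne_bot a, rfl, Set.Subset.antisymm a.2.2.1 ?_, rfl, fun x => ?_⟩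
  · obtain ⟨e, π, he⟩ := A.exists_isProjection
    have h1 : sigmaCone ⟨e, he.mem⟩ ∈ (partitionDual A).sets π := ⟨_, rfl⟩
    rw [h.2] at h1
    have h2 := (partitionDual_sets a.1 (ker_ne_bot a)
      (A := ⟨Set.range a.1, ?_, range_ne_univ a⟩) rfl π).ge h1
    · obtain ⟨b, hb⟩ := h2
      -- `b` is regarded as having values in `A`, because `σ`-cones are separated only among maps
      -- with a common proper image bound: if `X` has two elements, its two constant maps define the
      -- same `σ`-cone.
      have h3 := sigmaCone_injective A π
        (a₁ := ⟨b.1, b.2.1, b.2.2.1.trans a.2.2.1, b.2.2.2⟩) (a₂ := ⟨e, he.mem⟩) hb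
      have h4 : b.1 = e := congrArg Subtype.val h3
      rw [← he.range_eq, ← h4]
      exact b.2.2.1
    · obtain ⟨x, -⟩ := A.nonempty
      exact ⟨_, x, rfl⟩
  · have h1 := congrFun h.1.app_vertex (Quotient.mk _ x)
    exact Quotient.exact h1

/-- The `M`-set of the `H`-functor of `π` consists of the transversals of `π`. -/
theorem mem_mset_powersetDual [Nontrivial X] {π : PartitionCat X} {A : PowersetCat X} :
    A ∈ (powersetDual π).mset ↔ ∃ e, IsProjection e A π := by
  constructor
  · rintro ⟨ε, hε, hi⟩
    obtain ⟨a, hr, rfl, ha⟩ := exists_isProjection_of_powersetDual hε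
    obtain ⟨hinj, hsurj⟩ := PowersetCat.bijective_of_isIso ((rho a hr).app A)
    have h1 : ∀ x, ∃ y : A.set, a y.1 = a x := fun x => by
      obtain ⟨y, hy⟩ := hsurj ⟨a x, x, rfl⟩
      exact ⟨y, congrArg Subtype.val hy⟩
    -- `a` maps `A` bijectively onto `Im a`; `s x` is the unique point of `A` in the fibre of `a`
    -- through `x`, so `s` is the projection onto `A` along the kernel of `a`.
    choose s hs using h1
    have h2 : ∀ y z : A.set, a y.1 = a z.1 → y = z := fun y z h => hinj (Subtype.ext h)
    have h3 : ∀ x, (s (s x)) = s x := fun x => h2 _ _ (hs _)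
    refine ⟨fun x => (s x).1, Set.Subset.antisymm ?_ ?_, ?_, fun x => by rw [h3]⟩
    · rintro _ ⟨x, rfl⟩
      exact (s x).2
    · intro x hx
      exact ⟨x, congrArg Subtype.val (h2 (s x) ⟨x, hx⟩ (hs x))⟩
    · rw [← ha.ker_eq]
      ext x y
      change (s x).1 = (s y).1 ↔ a x = a y
      refine ⟨fun h => ?_, fun h => congrArg Subtype.val (h2 _ _ ?_)⟩
      · rw [← hs x, h, hs]
      · rw [hs, h, hs]
  · rintro ⟨e, he⟩
    have hr := range_ne_univ ⟨e, he.mem⟩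
    refine ⟨rho e hr, he.powersetDual_isGeneratedBy hr, ?_⟩
    have hv : imageObj e hr = A := imageObj_eq hr he.range_eq
    have h1 := (he.powersetDual_isGeneratedBy hr).1.app_vertex
    have key : ∀ B, B = (rho e hr).vertex → IsIso ((rho e hr).app B) := by
      rintro _ rfl
      rw [h1]
      infer_instance
    exact key A hv.symm

/-- The `M`-set of the `H`-functor of `A` consists of the partitions with transversal `A`. -/
theorem mem_mset_partitionDual {π : PartitionCat X} {A : PowersetCat X} :
    π ∈ (partitionDual A).mset ↔ ∃ e, IsProjection e A π := by
  constructor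
  · rintro ⟨ε, hε, hi⟩
    obtain ⟨a, hk, rfl, ha⟩ := exists_isProjection_of_partitionDual hε
    obtain ⟨hinj, hsurj⟩ := PartitionCat.bijective_of_isIso ((sigma a hk).app π)
    have h1 : ∀ x, ∃ y, π.rel (a y) x := fun x => by
      obtain ⟨y, hy⟩ := hsurj (Quotient.mk _ x)
      induction y using Quotient.inductionOn with
      | h y => exact ⟨y, Quotient.exact hy⟩
    -- Bijectivity of the component at `π` says that `Im a = A` meets every block of `π` exactly
    -- once. The desired projection sends `x` to the point of `A` in its block.
    have h2 : ∀ y z, π.rel (a y) (a z) → a y = a z := fun y z h =>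
      Quotient.exact (hinj (a₁ := Quotient.mk _ y) (a₂ := Quotient.mk _ z) (Quotient.sound h))
    choose s hs using h1
    refine ⟨fun x => a (s x), ?_, ?_, fun x => h2 _ _ (hs _)⟩
    · rw [← ha.range_eq]
      apply Set.Subset.antisymm
      · rintro _ ⟨x, rfl⟩
        exact ⟨_, rfl⟩
      · rintro _ ⟨x, rfl⟩
        exact ⟨a x, h2 _ _ (hs _)⟩
    · ext x y
      change a (s x) = a (s y) ↔ _
      refine ⟨fun h => ?_, fun h => h2 _ _ ?_⟩
      · have h3 := hs x
        rw [h] at h3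
        exact π.rel.trans (π.rel.symm h3) (hs y)
      · exact π.rel.trans (hs x) (π.rel.trans h (π.rel.symm (hs y)))
  · rintro ⟨e, he⟩
    have hk := ker_ne_bot ⟨e, he.mem⟩
    refine ⟨sigma e hk, he.partitionDual_isGeneratedBy hk, ?_⟩
    have hv : (⟨Setoid.ker e, hk⟩ : PartitionCat X) = π := PartitionCat.ext he.ker_eq
    have h1 := (he.partitionDual_isGeneratedBy hk).1.app_vertex
    have key : ∀ B, B = (sigma e hk).vertex → IsIso ((sigma e hk).app B) := by
      rintro _ rfl
      rw [h1]
      infer_instance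
    exact key π hv.symm

theorem IsProjection.descend_injective {e : X → X} {A : PowersetCat X} {π : PartitionCat X}
    (h : IsProjection e A π) : Function.Injective (descend ⟨e, h.mem⟩) := by
  intro x y
  induction x using Quotient.inductionOn
  induction y using Quotient.inductionOn
  exact fun hxy => Quotient.sound (h.ker_eq.le (congrArg Subtype.val hxy))

/-! ### The identifications with the normal duals are local isomorphisms -/

theorem toPowersetDual_map_app [Nontrivial X] {π π' : PartitionCat X} (η : π ⟶ π')
    (A : PowersetCat X) (a : transSet A π) :
    NatTrans.app (F := (powersetDual π).toFunctor) (G := (powersetDual π').toFunctor)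
      ((toPowersetDual X).map η) A (rhoEquiv A π a) = rhoEquiv A π' (transMap (𝟙 A) η a) := by
  change rhoEquiv A π' (transMap (𝟙 A) η ((rhoEquiv A π).symm (rhoEquiv A π a))) = _
  rw [Equiv.symm_apply_apply]

theorem toPartitionDual_map_app {A B : PowersetCat X} (f : A ⟶ B)
    (π : PartitionCat X) (a : transSet A π) :
    NatTrans.app (F := (partitionDual A).toFunctor) (G := (partitionDual B).toFunctor)
      ((toPartitionDual X).map f) π (sigmaEquiv A π a) = sigmaEquiv B π (transMap f (𝟙 π) a) := by
  change sigmaEquiv B π (transMap f (𝟙 π) ((sigmaEquiv A π).symm (sigmaEquiv A π a))) = _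
  rw [Equiv.symm_apply_apply]

theorem powersetDual_map_rhoEquiv [Nontrivial X] {A B : PowersetCat X} {π : PartitionCat X}
    (f : A ⟶ B) (a : transSet A π) :
    (powersetDual π).toFunctor.map f (rhoEquiv A π a) = rhoEquiv B π (transMap f (𝟙 π) a) :=
  Subtype.ext (rhoCone_act a f _)

theorem partitionDual_map_sigmaEquiv {A : PowersetCat X} {π π' : PartitionCat X}
    (u : π ⟶ π') (a : transSet A π) :
    (partitionDual A).toFunctor.map u (sigmaEquiv A π a) =
      sigmaEquiv A π' (transMap (𝟙 A) u a) :=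
  Subtype.ext (sigmaCone_act a u _)

theorem powersetDual_sub_iff [Nontrivial X] {π π' : PartitionCat X} :
    Sub (powersetDual π) (powersetDual π') ↔ Sub π π' := by
  constructor
  · intro h
    obtain ⟨e, B, he, -⟩ := π.exists_isProjection (Classical.arbitrary X)
    obtain ⟨b, hb⟩ := h B ⟨⟨e, he.mem⟩, rfl⟩
    have h3 : b.1 = e := rho_injective hb
    have h4 := b.2.2.2
    rw [h3, he.ker_eq] at h4
    exact h4
  · rintro h A _ ⟨a, rfl⟩
    exact ⟨⟨a.1, a.2.1, a.2.2.1, le_trans h a.2.2.2⟩, rfl⟩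

theorem partitionDual_sub {A B : PowersetCat X} (h : Sub A B) :
    Sub (partitionDual A) (partitionDual B) := by
  rintro π _ ⟨a, rfl⟩
  exact ⟨⟨a.1, a.2.1, a.2.2.1.trans h, a.2.2.2⟩, rfl⟩

theorem isLocalIso_toPowersetDual [Nontrivial X] : IsLocalIso (toPowersetDual X) where
  map_sub {π π'} h := by
    refine ⟨powersetDual_sub_iff.2 h, ?_⟩
    apply NatTrans.ext
    funext A
    ext x
    obtain ⟨a, rfl⟩ := (rhoEquiv A π).surjective x
    refine (toPowersetDual_map_app (incl h) A a).trans ?_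
    exact Subtype.ext rfl
  full := ⟨fun {π π'} τ => by
    change (powersetDual π).toFunctor ⟶ (powersetDual π').toFunctor at τ
    obtain ⟨e, B, he, -⟩ := π.exists_isProjection (Classical.arbitrary X)
    obtain ⟨b, hb⟩ := (rhoEquiv B π').surjective (τ.app B (rhoEquiv B π ⟨e, he.mem⟩))
    -- If `τ` sends `ρ^e` to `ρ^b`, the preimage of `τ` must satisfy `η e = b`. As `e` fixes the
    -- values of `b`, the block of the value of `b` is a solution.
    refine ⟨fun y => Quotient.mk _ (descend b y).1, ?_⟩
    apply NatTrans.ext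
    funext A
    ext x
    obtain ⟨a, rfl⟩ := (rhoEquiv A π).surjective x
    refine (toPowersetDual_map_app _ A a).trans ?_
    -- The factorization `a = e f`, with `f` the restriction of `a`, turns naturality along `f` into
    -- the value of `τ` at `ρ^a`.
    let f : B ⟶ A := fun y => ⟨a.1 y.1, a.2.2.1 ⟨_, rfl⟩⟩
    have ha : transMap f (𝟙 π) ⟨e, he.mem⟩ = a :=
      Subtype.ext (funext fun x => a.2.2.2 (he.rel_apply x))
    have h1 := NatTrans.naturality_apply τ f (rhoEquiv B π ⟨e, he.mem⟩)
    rw [powersetDual_map_rhoEquiv, ha, ← hb, powersetDual_map_rhoEquiv] at h1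
    exact Eq.trans rfl h1.symm⟩
  faithful := ⟨fun {π π'} η μ h => by
    obtain ⟨e, B, he, -⟩ := π.exists_isProjection (Classical.arbitrary X)
    have h1 := (toPowersetDual_map_app η B ⟨e, he.mem⟩).symm.trans
      ((congrArg (fun t : (powersetDual π).toFunctor ⟶ (powersetDual π').toFunctor =>
        t.app B (rhoEquiv B π ⟨e, he.mem⟩)) h).trans (toPowersetDual_map_app μ B ⟨e, he.mem⟩))
    have h2 := (rhoEquiv B π').injective h1
    funext y
    -- Evaluating at `ρ^e` gives `η e = μ e`, and `e` separates the blocks of its kernel `π`.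
    refine he.descend_injective ?_
    have h3 := congrArg (fun t => descend t y) h2
    simp only [descend_transMap] at h3
    exact h3⟩
  ideal π := by
    refine ⟨fun σ h => powersetDual_sub_iff.2 h, fun σ _ τ _ h => ?_, fun F hF => ?_⟩
    · change powersetDual σ = powersetDual τ at h
      exact sub_antisymm (powersetDual_sub_iff.1 (h ▸ sub_refl _))
        (powersetDual_sub_iff.1 (h ▸ sub_refl _))
    · obtain ⟨ε, hε⟩ : ∃ ε, F.IsGeneratedBy ε := F.exists_cone
      obtain ⟨B, a, rfl⟩ : ∃ B, ε ∈ (powersetDual π).sets B := ⟨_, hF _ hε.mem⟩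
      refine ⟨⟨_, ker_ne_bot a⟩, a.2.2.2, NormalDual.ext (funext fun A => ?_)⟩
      exact (powersetDual_sets a.1 (range_ne_univ a) rfl A).trans (hε.2 A).symm

theorem isLocalIso_toPartitionDual [Nontrivial X] : IsLocalIso (toPartitionDual X) where
  map_sub {A B} h := by
    refine ⟨partitionDual_sub h, ?_⟩
    apply NatTrans.ext
    funext π
    ext x
    obtain ⟨a, rfl⟩ := (sigmaEquiv A π).surjective x
    refine (toPartitionDual_map_app (incl h) π a).trans ?_
    exact Subtype.ext rfl
  full := ⟨fun {A A'} τ => by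
    change (partitionDual A).toFunctor ⟶ (partitionDual A').toFunctor at τ
    obtain ⟨e, α, he⟩ := A.exists_isProjection
    obtain ⟨b, hb⟩ := (sigmaEquiv A' α).surjective (τ.app α (sigmaEquiv A α ⟨e, he.mem⟩))
    -- If `τ` sends `σ^e` to `σ^b`, the preimage must satisfy `e f = b`; as `e` fixes `A` pointwise,
    -- `f` is the restriction of `b` to `A`.
    refine ⟨fun y => descend b (Quotient.mk _ y.1), ?_⟩
    apply NatTrans.ext
    funext π
    ext x
    obtain ⟨a, rfl⟩ := (sigmaEquiv A π).surjective x
    refine (toPartitionDual_map_app _ π a).trans ?_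
    -- Here `u e = a`, because `e` fixes the values of `a`; naturality along `u` then gives the
    -- value of `τ` at `σ^a`.
    let u : α ⟶ π := fun y => Quotient.mk _ (descend a y).1
    have ha : transMap (𝟙 A) u ⟨e, he.mem⟩ = a :=
      Subtype.ext (funext fun x => he.apply_of_mem (a.2.2.1 ⟨x, rfl⟩))
    have h1 := NatTrans.naturality_apply τ u (sigmaEquiv A α ⟨e, he.mem⟩)
    rw [partitionDual_map_sigmaEquiv, ha, ← hb, partitionDual_map_sigmaEquiv] at h1
    exact Eq.trans rfl h1.symm⟩
  faithful := ⟨fun {A B} f g h => by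
    obtain ⟨e, π, he⟩ := A.exists_isProjection
    have h1 := (toPartitionDual_map_app f π ⟨e, he.mem⟩).symm.trans
      ((congrArg (fun t : (partitionDual A).toFunctor ⟶ (partitionDual B).toFunctor =>
        t.app π (sigmaEquiv A π ⟨e, he.mem⟩)) h).trans (toPartitionDual_map_app g π ⟨e, he.mem⟩))
    have h2 := (sigmaEquiv B π).injective h1
    funext y
    have h3 := congrArg (fun t => descend t (Quotient.mk _ y.1)) h2
    simp only [descend_transMap] at h3
    have h4 : descend ⟨e, he.mem⟩ (Quotient.mk _ y.1) = y := Subtype.ext (he.apply_of_mem y.2)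
    change f (descend ⟨e, he.mem⟩ (Quotient.mk _ y.1)) =
      g (descend ⟨e, he.mem⟩ (Quotient.mk _ y.1)) at h3
    rwa [h4] at h3⟩
  ideal A := by
    -- The common bound `A` cannot be dropped: for a two-element `X` the two singletons have the
    -- same `H`-functor. A local isomorphism needs injectivity only below a fixed object.
    have key : ∀ B D : PowersetCat X, Sub B A → Sub D A →
        Sub (partitionDual B) (partitionDual D) → Sub B D := by
      intro B D hB hD h
      obtain ⟨e, π, he⟩ := B.exists_isProjection
      obtain ⟨b, hb⟩ := h π ⟨⟨e, he.mem⟩, rfl⟩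
      have h3 := sigmaCone_injective A π
        (a₁ := ⟨b.1, b.2.1, b.2.2.1.trans hD, b.2.2.2⟩)
        (a₂ := ⟨e, he.mem.1, he.mem.2.1.trans hB, he.mem.2.2⟩) hb
      have h4 : b.1 = e := congrArg Subtype.val h3
      change B.set ⊆ D.set
      rw [← he.range_eq, ← h4]
      exact b.2.2.1
    refine ⟨fun B h => partitionDual_sub h, fun B hB D hD h => ?_, fun F hF => ?_⟩
    · change partitionDual B = partitionDual D at h
      exact sub_antisymm (key _ _ hB hD (h ▸ sub_refl _)) (key _ _ hD hB (h ▸ sub_refl _))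
    · obtain ⟨ε, hε⟩ : ∃ ε, F.IsGeneratedBy ε := F.exists_cone
      obtain ⟨π, a, rfl⟩ : ∃ π, ε ∈ (partitionDual A).sets π := ⟨_, hF _ hε.mem⟩
      refine ⟨imageObj a.1 (range_ne_univ a), a.2.2.1, NormalDual.ext (funext fun π => ?_)⟩
      exact (partitionDual_sets a.1 (ker_ne_bot a) rfl π).trans (hε.2 π).symm

/-! ### The functors induced by a permutation are local isomorphisms -/

theorem preimagePartition_symm (θ : Equiv.Perm X) (π : PartitionCat X) :
    preimagePartition θ (preimagePartition θ.symm π) = π := by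
  refine PartitionCat.ext (Setoid.ext fun x y => ?_)
  change π.rel (θ.symm (θ x)) (θ.symm (θ y)) ↔ _
  simp

theorem isLocalIso_powersetPerm (θ : Equiv.Perm X) : IsLocalIso (powersetPerm θ) where
  map_sub {A B} h := ⟨Set.image_mono h, funext fun y => Subtype.ext (θ.apply_symm_apply _)⟩
  full := ⟨fun {A B} g => by
    have hg : ∀ x : A.set, θ.symm (g ⟨θ x.1, x.1, x.2, rfl⟩).1 ∈ B.set := fun x =>
      Set.mem_image_equiv.1 (g ⟨θ x.1, x.1, x.2, rfl⟩).2
    refine ⟨fun x => ⟨_, hg x⟩, funext fun y => Subtype.ext ?_⟩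
    refine (θ.apply_symm_apply _).trans ?_
    exact congrArg (fun t => (g t).1) (Subtype.ext (θ.apply_symm_apply _))⟩
  faithful := ⟨fun {A B} f g h => by
    funext x
    have h1 := congrArg Subtype.val (congrFun h ⟨θ x.1, x.1, x.2, rfl⟩)
    have h2 := θ.injective h1
    have h3 : (⟨θ.symm (θ x.1), Set.mem_image_equiv.1 ⟨x.1, x.2, rfl⟩⟩ : A.set) = x :=
      Subtype.ext (θ.symm_apply_apply _)
    change (f ⟨θ.symm (θ x.1), _⟩).1 = (g ⟨θ.symm (θ x.1), _⟩).1 at h2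
    rw [h3] at h2
    exact Subtype.ext h2⟩
  ideal A := by
    refine ⟨fun B h => Set.image_mono h, fun B _ D _ h => ?_, fun B hB => ?_⟩
    · exact PowersetCat.ext (θ.injective.image_injective (congrArg PowersetCat.set h))
    · have h1 : θ '' (θ.symm '' B.set) = B.set := θ.image_symm_image B.set
      refine ⟨(powersetPerm θ.symm).obj B, ?_, PowersetCat.ext h1⟩
      rintro _ ⟨x, hx, rfl⟩
      exact Set.mem_image_equiv.1 (hB hx)

theorem isLocalIso_partitionPerm (θ : Equiv.Perm X) : IsLocalIso (partitionPerm θ) where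
  map_sub {π π'} h := ⟨fun {_ _} hxy => h hxy, funext fun y => Quotient.inductionOn y fun x =>
    congrArg (Quotient.mk _) (θ.symm_apply_apply x)⟩
  full := ⟨fun {π π'} g => ⟨fun y => blockEquiv θ π (g ((blockEquiv θ π').symm y)), by
    funext y
    change (blockEquiv θ π).symm (blockEquiv θ π (g ((blockEquiv θ π').symm
      (blockEquiv θ π' y)))) = g y
    exact ((blockEquiv θ π).symm_apply_apply _).trans
      (congrArg g ((blockEquiv θ π').symm_apply_apply y))⟩⟩
  faithful := ⟨fun {π π'} f g h => by
    funext y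
    have h1 := congrFun h ((blockEquiv θ π').symm y)
    change (blockEquiv θ π).symm (f (blockEquiv θ π' ((blockEquiv θ π').symm y))) =
      (blockEquiv θ π).symm (g (blockEquiv θ π' ((blockEquiv θ π').symm y))) at h1
    rw [Equiv.apply_symm_apply] at h1
    exact (blockEquiv θ π).symm.injective h1⟩
  ideal π := by
    have key : ∀ σ τ : PartitionCat X, Sub (preimagePartition θ σ) (preimagePartition θ τ) →
        Sub σ τ := by
      intro σ τ h x y hxy
      have h1 : (preimagePartition θ τ).rel (θ.symm x) (θ.symm y) := by
        change τ.rel (θ (θ.symm x)) (θ (θ.symm y))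
        simpa using hxy
      have h2 : σ.rel (θ (θ.symm x)) (θ (θ.symm y)) := h h1
      simpa using h2
    refine ⟨fun σ h x y hxy => h hxy, fun σ _ τ _ h => ?_, fun σ hσ => ?_⟩
    · change preimagePartition θ σ = preimagePartition θ τ at h
      exact sub_antisymm (key _ _ (h ▸ sub_refl _)) (key _ _ (h ▸ sub_refl _))
    · refine ⟨preimagePartition θ.symm σ, key _ _ ?_, preimagePartition_symm θ σ⟩
      rw [preimagePartition_symm]
      exact hσ

/-! ### Conjugation by a permutation -/

/-- The bijection `a ↦ θ⁻¹ a θ` (composition from left to right). -/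
def conjEquiv (θ : Equiv.Perm X) (A : PowersetCat X) (π : PartitionCat X) :
    transSet A (preimagePartition θ π) ≃ transSet ((powersetPerm θ).obj A) π where
  toFun a := ⟨fun x => θ (a.1 (θ.symm x)), mem_transSet (fun x => ⟨_, a.2.2.1 ⟨_, rfl⟩, rfl⟩)
    fun {x y} hxy => congrArg θ (a.2.2.2 (by
      change π.rel (θ (θ.symm x)) (θ (θ.symm y))
      simpa using hxy))⟩
  invFun b := ⟨fun x => θ.symm (b.1 (θ x)), mem_transSet
    (fun x => Set.mem_image_equiv.1 (b.2.2.1 ⟨_, rfl⟩))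
    fun {x y} hxy => congrArg θ.symm (b.2.2.2 hxy)⟩
  left_inv a := Subtype.ext (by simp)
  right_inv b := Subtype.ext (by simp)

theorem symm_descend_conjEquiv (θ : Equiv.Perm X) {A : PowersetCat X} {π : PartitionCat X}
    (a : transSet A (preimagePartition θ π)) (q : Quotient π.rel) :
    θ.symm (descend (conjEquiv θ A π a) q).1 = (descend a ((blockEquiv θ π).symm q)).1 :=
  Quotient.inductionOn q fun _ => θ.symm_apply_apply _

/-- This is the naturality of `χ`: with composition from left to right, `θ⁻¹ (θ u θ⁻¹) a f θ = u
(θ⁻¹ a θ) (θ⁻¹ f θ)`. The passage through blocks is handled by `symm_descend_conjEquiv`. -/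
theorem conjEquiv_transMap (θ : Equiv.Perm X) {A B : PowersetCat X} {π π' : PartitionCat X}
    (f : A ⟶ B) (u : π ⟶ π') (a : transSet A (preimagePartition θ π)) :
    conjEquiv θ B π' (transMap f ((partitionPerm θ).map u) a) =
      transMap ((powersetPerm θ).map f) u (conjEquiv θ A π a) := by
  refine Subtype.ext (funext fun x => ?_)
  have h1 : blockEquiv θ π' (Quotient.mk _ (θ.symm x)) = Quotient.mk _ x :=
    congrArg (Quotient.mk _) (θ.apply_symm_apply x)
  change θ (f (descend a ((blockEquiv θ π).symm
    (u (blockEquiv θ π' (Quotient.mk _ (θ.symm x))))))).1 = θ (f ⟨θ.symm _, _⟩).1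
  refine congrArg (fun t => θ (f t).1) (Subtype.ext ?_)
  rw [h1]
  exact (symm_descend_conjEquiv θ a _).symm

/-- Conjugation by `θ` as an isomorphism of bifunctors. -/
def conjIso (θ : Equiv.Perm X) :
    gammaBifunctor (partitionPerm θ) ≅ deltaBifunctor (powersetPerm θ) :=
  NatIso.ofComponents (fun P => (conjEquiv θ P.1 P.2).toIso) fun {P P'} g => by
    ext a
    exact conjEquiv_transMap θ g.1 g.2 a

/-- Together with `IsProjection.conj_symm` this transports transversality: `A` is a transversal of
`θ⁻¹(π)` if and only if `θ(A)` is one of `π`. -/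
theorem IsProjection.conj {θ : Equiv.Perm X} {e : X → X} {A : PowersetCat X} {π : PartitionCat X}
    (h : IsProjection e A (preimagePartition θ π)) :
    IsProjection (fun x => θ (e (θ.symm x))) ((powersetPerm θ).obj A) π where
  range_eq := by
    change _ = θ '' A.set
    rw [← h.range_eq]
    apply Set.Subset.antisymm
    · rintro _ ⟨x, rfl⟩
      exact ⟨_, ⟨_, rfl⟩, rfl⟩
    · rintro _ ⟨_, ⟨x, rfl⟩, rfl⟩
      exact ⟨θ x, by simp⟩
  ker_eq := by
    ext x y
    change θ (e (θ.symm x)) = θ (e (θ.symm y)) ↔ _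
    have h1 : Setoid.ker e (θ.symm x) (θ.symm y) ↔ π.rel (θ (θ.symm x)) (θ (θ.symm y)) := by
      rw [h.ker_eq]
      rfl
    rw [θ.apply_symm_apply, θ.apply_symm_apply] at h1
    exact θ.injective.eq_iff.trans h1
  idem x := by simp [h.idem]

theorem IsProjection.conj_symm {θ : Equiv.Perm X} {e : X → X} {A : PowersetCat X}
    {π : PartitionCat X} (h : IsProjection e ((powersetPerm θ).obj A) π) :
    IsProjection (fun x => θ.symm (e (θ x))) A (preimagePartition θ π) where
  range_eq := by
    have h1 : A.set = θ.symm '' (θ '' A.set) := (θ.symm_image_image A.set).symm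
    have h2 : Set.range e = θ '' A.set := h.range_eq
    rw [h1, ← h2]
    apply Set.Subset.antisymm
    · rintro _ ⟨x, rfl⟩
      exact ⟨_, ⟨_, rfl⟩, rfl⟩
    · rintro _ ⟨_, ⟨x, rfl⟩, rfl⟩
      exact ⟨θ.symm x, by simp⟩
  ker_eq := by
    ext x y
    change θ.symm (e (θ x)) = θ.symm (e (θ y)) ↔ π.rel (θ x) (θ y)
    rw [θ.symm.injective.eq_iff, ← h.ker_eq]
    rfl
  idem x := by simp [h.idem]

/-! ### Cross-connections and the duality -/

theorem isCrossConnection_gammaPerm [Nontrivial X] (θ : Equiv.Perm X) :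
    IsCrossConnection (gammaPerm θ) where
  isLocalIso := (isLocalIso_partitionPerm θ).comp isLocalIso_toPowersetDual
  exists_mem_mset A := by
    obtain ⟨e, π, he⟩ := A.exists_isProjection
    refine ⟨preimagePartition θ.symm π, ?_⟩
    change A ∈ (powersetDual (preimagePartition θ (preimagePartition θ.symm π))).mset
    rw [preimagePartition_symm]
    exact mem_mset_powersetDual.2 ⟨e, he⟩

theorem mem_mset_gammaPerm_iff [Nontrivial X] (θ : Equiv.Perm X) (A : PowersetCat X)
    (π : PartitionCat X) :
    A ∈ ((gammaPerm θ).obj π).mset ↔ π ∈ ((deltaPerm θ).obj A).mset :=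
  mem_mset_powersetDual.trans (Iff.trans
    ⟨fun ⟨_, he⟩ => ⟨_, he.conj⟩, fun ⟨_, he⟩ => ⟨_, he.conj_symm⟩⟩ mem_mset_partitionDual.symm)

theorem isCrossConnection_deltaPerm [Nontrivial X] (θ : Equiv.Perm X) :
    IsCrossConnection (deltaPerm θ) where
  isLocalIso := (isLocalIso_powersetPerm θ).comp isLocalIso_toPartitionDual
  exists_mem_mset π := by
    obtain ⟨e, A, he, -⟩ := (preimagePartition θ π).exists_isProjection (Classical.arbitrary X)
    exact ⟨A, mem_mset_partitionDual.2 ⟨_, he.conj⟩⟩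

/-- The duality `ρ^a ↦ σ^{θ⁻¹ a θ}`. -/
noncomputable def permDuality [Nontrivial X] (θ : Equiv.Perm X) :
    bifunctorLeft (gammaPerm θ) ≅ bifunctorRight (deltaPerm θ) :=
  (gammaCone (partitionPerm θ)).symm ≪≫ conjIso θ ≪≫ deltaCone (powersetPerm θ)

/-- The cone that corresponds to `ρ^a` under a natural isomorphism from `Γ_θ(-,-)`. -/
noncomputable def imageCone [Nontrivial X] {θ : Equiv.Perm X}
    {Δ : PowersetCat X ⥤ NormalDual (PartitionCat X)}
    (χ : bifunctorLeft (gammaPerm θ) ≅ bifunctorRight Δ) {A : PowersetCat X} {π : PartitionCat X}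
    (a : transSet A (preimagePartition θ π)) : SubCone (PartitionCat X) :=
  coneRight (χ.hom.app (A, π) ((gammaCone (partitionPerm θ)).hom.app (A, π) a))

theorem imageCone_permDuality [Nontrivial X] (θ : Equiv.Perm X) {A : PowersetCat X}
    {π : PartitionCat X} (a : transSet A (preimagePartition θ π)) :
    imageCone (permDuality θ) a = sigmaCone (conjEquiv θ A π a) := by
  have h1 : (gammaCone (partitionPerm θ)).inv.app (A, π)
      ((gammaCone (partitionPerm θ)).hom.app (A, π) a) = a :=
    (rhoEquiv A (preimagePartition θ π)).symm_apply_apply a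
  change coneRight ((deltaCone (powersetPerm θ)).hom.app (A, π) ((conjIso θ).hom.app (A, π)
    ((gammaCone (partitionPerm θ)).inv.app (A, π)
      ((gammaCone (partitionPerm θ)).hom.app (A, π) a)))) = _
  rw [h1]
  rfl

theorem gammaCone_app_surjective [Nontrivial X] (Γ : PartitionCat X ⥤ PartitionCat X)
    (A : PowersetCat X) (π : PartitionCat X)
    (x : (bifunctorLeft (Γ ⋙ toPowersetDual X)).obj (A, π)) :
    ∃ a : transSet A (Γ.obj π), (gammaCone Γ).hom.app (A, π) a = x :=
  (rhoEquiv A (Γ.obj π)).surjective x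

theorem isDuality_permDuality [Nontrivial X] (θ : Equiv.Perm X) :
    IsDuality (gammaPerm θ) (deltaPerm θ) (permDuality θ) where
  left := isCrossConnection_gammaPerm θ
  right := isCrossConnection_deltaPerm θ
  mem_mset_iff := mem_mset_gammaPerm_iff θ
  map_idempotent A π x hv hg := by
    obtain ⟨a, rfl⟩ := gammaCone_app_surjective (partitionPerm θ) A π x
    obtain ⟨b, hb, hab, h⟩ := exists_isProjection_of_powersetDual hg
    -- The transformation supplied by the generator is the given `a`, which is therefore a
    -- projection onto `A` along `θ⁻¹(π)`.
    have h1 : a.1 = b := rho_injective hab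
    rw [hv, ← h1] at h
    have key : ∀ γ, γ = sigmaCone (conjEquiv θ A π a) →
        γ.vertex = π ∧ ((deltaPerm θ).obj A).IsGeneratedBy γ := by
      rintro _ rfl
      exact ⟨PartitionCat.ext h.conj.ker_eq,
        h.conj.partitionDual_isGeneratedBy (ker_ne_bot (conjEquiv θ A π a))⟩
    exact key _ (imageCone_permDuality θ a)

/-! ### Uniqueness -/

theorem coneRight_injective {C D : Type u} [SmallCategory C] [SmallCategory D] [NormalCategory C]
    [NormalCategory D] {Δ : C ⥤ NormalDual D} {c : C} {d : D} :
    Function.Injective (coneRight : (bifunctorRight Δ).obj (c, d) → SubCone D) :=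
  Subtype.val_injective

/-- A local isomorphism sends an inclusion to the inclusion of a subfunctor, which leaves the
underlying cones unchanged; only `u` acts. In the uniqueness argument, this is how the otherwise
unknown action of `Δ` on morphisms is controlled. -/
theorem coneRight_map_incl {C D : Type u} [SmallCategory C] [SmallCategory D] [NormalCategory C]
    [NormalCategory D] {Δ : C ⥤ NormalDual D} (hΔ : IsLocalIso Δ) {c c' : C} {d d' : D}
    (h : Sub c c') (u : d ⟶ d') (x : (bifunctorRight Δ).obj (c, d))
    (hx : Sub (coneRight x).vertex d) :
    coneRight ((bifunctorRight Δ).map (Prod.mkHom (incl h) u) x) = (coneRight x).act hx u := by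
  obtain ⟨k, hk⟩ := hΔ.map_sub h
  have key : ∀ t : Δ.obj c ⟶ Δ.obj c', t = incl k →
      (((Δ.obj c').toFunctor.map u) (NatTrans.app (F := (Δ.obj c).toFunctor)
        (G := (Δ.obj c').toFunctor) t d x)).1 = (coneRight x).act hx u := by
    rintro _ rfl
    rfl
  exact key _ hk

theorem coneRight_map_id {C D : Type u} [SmallCategory C] [SmallCategory D] [NormalCategory C]
    [NormalCategory D] (Δ : C ⥤ NormalDual D) {c c' : C} (f : c ⟶ c') (d : D)
    (x : (bifunctorRight Δ).obj (c, d)) :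
    coneRight ((bifunctorRight Δ).map (Prod.mkHom f (𝟙 d)) x) =
      Subtype.val (p := (· ∈ (Δ.obj c').sets d)) (NatTrans.app (F := (Δ.obj c).toFunctor)
        (G := (Δ.obj c').toFunctor) (Δ.map f) d x) :=
  congrArg (fun t : (Δ.obj c').toFunctor.obj d ⟶ (Δ.obj c').toFunctor.obj d =>
    Subtype.val (p := (· ∈ (Δ.obj c').sets d)) (t (NatTrans.app (F := (Δ.obj c).toFunctor)
      (G := (Δ.obj c').toFunctor) (Δ.map f) d x))) ((Δ.obj c').toFunctor.map_id d)

theorem deltaPerm_map_app (θ : Equiv.Perm X) {A B : PowersetCat X} (f : A ⟶ B)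
    (π : PartitionCat X) (y : ((deltaPerm θ).obj A).sets π)
    (b : transSet ((powersetPerm θ).obj A) π) (hy : y.1 = sigmaCone b) :
    Subtype.val (p := (· ∈ ((deltaPerm θ).obj B).sets π))
      (NatTrans.app (F := ((deltaPerm θ).obj A).toFunctor) (G := ((deltaPerm θ).obj B).toFunctor)
        ((deltaPerm θ).map f) π y) = sigmaCone (transMap ((powersetPerm θ).map f) (𝟙 π) b) := by
  obtain rfl : y = sigmaEquiv _ π b := Subtype.ext hy
  exact congrArg Subtype.val (toPartitionDual_map_app ((powersetPerm θ).map f) π b)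

/-- The components of `γ.act h u` on the block of `z` are those of `γ` on the image of this block
under `u`. -/
theorem SubCone.act_app_mk (γ : SubCone (PartitionCat X)) {π π' : PartitionCat X}
    (h : Sub γ.vertex π) (u : π ⟶ π') (β : PartitionCat X) (z w : X)
    (hw : u (Quotient.mk _ z) = Quotient.mk _ w) :
    (γ.act h u).app β (Quotient.mk _ z) = γ.app β (Quotient.mk _ w) := by
  -- The inclusion of the image only passes to a coarser block with the same representative, so
  -- `epi_incl` can be read at `z`.
  have h1 : epi (incl h ≫ u) (Quotient.mk _ z) = PartitionCat.coarsen h (u (Quotient.mk _ z)) :=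
    congrFun (epi_incl (incl h ≫ u)) (Quotient.mk _ z)
  rw [hw] at h1
  exact congrArg (γ.app β) h1

theorem SubCone.eq_sigma {γ : SubCone (PartitionCat X)} {a : X → X} (hk : Setoid.ker a ≠ ⊥)
    (hv : γ.vertex.rel = Setoid.ker a)
    (h : ∀ β z, γ.app β (Quotient.mk _ z) = Quotient.mk _ (a z)) : γ = sigma a hk := by
  obtain ⟨v, t, ht⟩ := γ
  have : v = ⟨_, hk⟩ := PartitionCat.ext hv
  subst this
  have : t = (sigma a hk).app := funext fun β => funext fun y => Quotient.inductionOn y (h β)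
  subst this
  rfl

/-! ### The cones that correspond to the `ρ^a` under an arbitrary duality -/

section

variable [Nontrivial X] {θ : Equiv.Perm X} {Δ : PowersetCat X ⥤ NormalDual (PartitionCat X)}
  (χ : bifunctorLeft (gammaPerm θ) ≅ bifunctorRight Δ)

theorem imageCone_mem {A : PowersetCat X} {π : PartitionCat X}
    (a : transSet A (preimagePartition θ π)) : imageCone χ a ∈ (Δ.obj A).sets π :=
  Subtype.property _

theorem exists_imageCone_eq {A : PowersetCat X} {π : PartitionCat X}
    {γ : SubCone (PartitionCat X)} (hγ : γ ∈ (Δ.obj A).sets π) :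
    ∃ a : transSet A (preimagePartition θ π), imageCone χ a = γ := by
  obtain ⟨a, ha⟩ := gammaCone_app_surjective (partitionPerm θ) A π (χ.inv.app (A, π) ⟨γ, hγ⟩)
  refine ⟨a, ?_⟩
  have h1 : χ.hom.app (A, π) (χ.inv.app (A, π) ⟨γ, hγ⟩) = ⟨γ, hγ⟩ :=
    congrArg (fun t : bifunctorRight Δ ⟶ bifunctorRight Δ => t.app (A, π) ⟨γ, hγ⟩) χ.inv_hom_id
  change coneRight (χ.hom.app (A, π) ((gammaCone (partitionPerm θ)).hom.app (A, π) a)) = γ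
  have h2 := (congrArg (χ.hom.app (A, π)) ha).trans h1
  exact congrArg coneRight h2

theorem imageCone_transMap {A B : PowersetCat X} {π π' : PartitionCat X} (f : A ⟶ B) (u : π ⟶ π')
    (a : transSet A (preimagePartition θ π)) :
    imageCone χ (transMap f ((partitionPerm θ).map u) a) =
      coneRight ((bifunctorRight Δ).map (Prod.mkHom f u)
        (χ.hom.app (A, π) ((gammaCone (partitionPerm θ)).hom.app (A, π) a))) :=
  congrArg coneRight (NatTrans.naturality_apply ((gammaCone (partitionPerm θ)).hom ≫ χ.hom)
    (Prod.mkHom f u : (A, π) ⟶ (B, π')) a)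

variable {χ}

theorem imageCone_transMap_incl (hΔ : IsLocalIso Δ) {A B : PowersetCat X} {π π' : PartitionCat X}
    (h : Sub A B) (u : π ⟶ π') (a : transSet A (preimagePartition θ π))
    (hs : Sub (imageCone χ a).vertex π) :
    imageCone χ (transMap (incl h) ((partitionPerm θ).map u) a) = (imageCone χ a).act hs u :=
  (imageCone_transMap χ (incl h) u a).trans (coneRight_map_incl hΔ h u _ hs)

theorem imageCone_vertex_sub {A : PowersetCat X} {π : PartitionCat X}
    (a : transSet A (preimagePartition θ π)) : Sub (imageCone χ a).vertex π :=
  (Δ.obj A).sub_of_mem (imageCone_mem χ a)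

/-- The values of the cones that correspond to the `ρ^a` depend only on those of `θ⁻¹ a`. -/
theorem imageCone_app_congr (hΔ : IsLocalIso Δ) {A B : PowersetCat X} {π π' : PartitionCat X}
    (a : transSet A (preimagePartition θ π)) (b : transSet B (preimagePartition θ π')) {z w : X}
    (h : a.1 (θ.symm z) = b.1 (θ.symm w)) (β : PartitionCat X) :
    (imageCone χ a).app β (Quotient.mk _ z) = (imageCone χ b).app β (Quotient.mk _ w) := by
  let y := a.1 (θ.symm z)
  obtain ⟨y', hy'⟩ := exists_ne y
  let S : PowersetCat X :=
    ⟨{y}, ⟨y, rfl⟩, fun e => hy' (e.symm ▸ Set.mem_univ y' : y' ∈ ({y} : Set X))⟩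
  -- The constant map `k` with value `y`, having one-point image and one-block kernel, serves as a
  -- common reference for `a` and `b`.
  let τ : PartitionCat X := ⟨⊤, fun e => hy' (e.le (trivial : (⊤ : Setoid X) y' y))⟩
  let k : transSet S (preimagePartition θ τ) :=
    ⟨fun _ => y, mem_transSet (fun _ => rfl) fun {_ _} _ => rfl⟩
  have key : ∀ {D : PowersetCat X} {σ : PartitionCat X} (d : transSet D (preimagePartition θ σ))
      (v : X) (_ : d.1 (θ.symm v) = y),
      (imageCone χ d).app β (Quotient.mk _ v) = (imageCone χ k).app β (Quotient.mk _ y) := by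
    intro D σ d v hv
    have hS : Sub S D := by
      rintro _ rfl
      exact hv ▸ d.2.2.1 ⟨_, rfl⟩
    -- Selecting the block of `v` before applying `d` gives the constant map with value `y`. Inside
    -- `D` it equals `k` followed by the inclusion of `{y}`, so both routes yield the same cone.
    let u : σ ⟶ τ := fun _ => Quotient.mk _ v
    have h1 : transMap (incl (sub_refl D)) ((partitionPerm θ).map u) d =
        transMap (incl hS) ((partitionPerm θ).map (𝟙 τ)) k :=
      Subtype.ext (funext fun _ => hv)
    have h2 := (imageCone_transMap_incl hΔ _ u d (imageCone_vertex_sub _)).symm.trans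
      ((congrArg (imageCone χ) h1).trans
        (imageCone_transMap_incl hΔ hS (𝟙 τ) k (imageCone_vertex_sub _)))
    have h3 : ∀ γ δ : SubCone (PartitionCat X), γ = δ →
        γ.app β (Quotient.mk _ y) = δ.app β (Quotient.mk _ y) := by
      rintro γ _ rfl
      rfl
    have h4 := h3 _ _ h2
    rwa [SubCone.act_app_mk _ _ u β y v rfl, SubCone.act_app_mk _ _ (𝟙 τ) β y y rfl] at h4
  rw [key a z rfl, key b w h.symm]

theorem IsDuality.imageCone_isProjection (h : IsDuality (gammaPerm θ) Δ χ) {e : X → X}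
    {A : PowersetCat X} {π : PartitionCat X} (he : IsProjection e A (preimagePartition θ π)) :
    (imageCone χ ⟨e, he.mem⟩).vertex = π ∧
      (Δ.obj A).IsGeneratedBy (imageCone χ ⟨e, he.mem⟩) :=
  h.map_idempotent A π ((gammaCone (partitionPerm θ)).hom.app (A, π) ⟨e, he.mem⟩)
    (PowersetCat.ext he.range_eq) (he.powersetDual_isGeneratedBy (range_ne_univ ⟨e, he.mem⟩))

theorem IsDuality.imageCone_app (h : IsDuality (gammaPerm θ) Δ χ) {A : PowersetCat X}
    {π : PartitionCat X} (a : transSet A (preimagePartition θ π)) (β : PartitionCat X) (z : X) :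
    (imageCone χ a).app β (Quotient.mk _ z) = Quotient.mk _ (θ (a.1 (θ.symm z))) := by
  -- Since `e` fixes the point `a.1 (θ.symm z)`, the cone of `a` at `z` may be replaced by that of
  -- `e` at `θ` of this point. The kernel of `e` is chosen so that the new cone has vertex `β`.
  obtain ⟨e, B, he, hy⟩ := (preimagePartition θ β).exists_isProjection (a.1 (θ.symm z))
  rw [imageCone_app_congr h.right.isLocalIso a (⟨e, he.mem⟩ : transSet B (preimagePartition θ β))
    (w := θ (a.1 (θ.symm z))) (by
      change _ = e _
      rw [θ.symm_apply_apply, he.apply_of_mem hy])]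
  obtain ⟨hv, hg⟩ := h.imageCone_isProjection he
  have h1 := hg.1.app_vertex
  have key : ∀ γ : SubCone (PartitionCat X), γ.vertex = β → γ.app γ.vertex = 𝟙 _ → ∀ x,
      γ.app β (Quotient.mk _ x) = Quotient.mk _ x := by
    rintro γ rfl h x
    exact congrFun h _
  exact key _ hv h1 _

/-- The bijection associated with a dual cross-connection of `Γ_θ` sends `ρ^a` to
`σ^{θ⁻¹ a θ}`. -/
theorem IsDuality.imageCone_eq (h : IsDuality (gammaPerm θ) Δ χ) {A : PowersetCat X}
    {π : PartitionCat X} (a : transSet A (preimagePartition θ π)) :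
    imageCone χ a = sigmaCone (conjEquiv θ A π a) := by
  -- The components are known from `IsDuality.imageCone_app`, but not yet the vertex. For a
  -- projection the duality prescribes it; a general `a` is obtained from `e` by the action of `u`.
  obtain ⟨e, σ, he⟩ := A.exists_isProjection
  obtain ⟨π', rfl⟩ : ∃ π', preimagePartition θ π' = σ := ⟨_, preimagePartition_symm θ σ⟩
  have h1 : imageCone χ ⟨e, he.mem⟩ = sigmaCone (conjEquiv θ A π' ⟨e, he.mem⟩) :=
    SubCone.eq_sigma _ ((congrArg PartitionCat.rel (h.imageCone_isProjection he).1).trans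
      he.conj.ker_eq.symm) (h.imageCone_app ⟨e, he.mem⟩)
  -- The map `u` is chosen so that `(θ u θ⁻¹) e = a`; this holds because `e` fixes the values of
  -- `a`.
  let u : π' ⟶ π := fun y => Quotient.mk _ (descend (conjEquiv θ A π a) y).1
  have h2 : transMap (incl (sub_refl A)) ((partitionPerm θ).map u) ⟨e, he.mem⟩ = a := by
    refine Subtype.ext (funext fun x => ?_)
    change e (θ.symm (θ (a.1 (θ.symm (θ x))))) = a.1 x
    rw [θ.symm_apply_apply, θ.symm_apply_apply, he.apply_of_mem (a.2.2.1 ⟨x, rfl⟩)]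
  have h3 := (congrArg (imageCone χ) h2).symm.trans
    (imageCone_transMap_incl h.right.isLocalIso _ u ⟨e, he.mem⟩ (imageCone_vertex_sub _))
  have h4 : (powersetPerm θ).map (incl (sub_refl A)) = 𝟙 _ := by
    rw [incl_refl, CategoryTheory.Functor.map_id]
  have h5 := (congrArg (conjEquiv θ A π) h2).symm.trans (conjEquiv_transMap θ _ u ⟨e, he.mem⟩)
  rw [h4] at h5
  have key : ∀ γ (hs : Sub γ.vertex π'), γ = sigmaCone (conjEquiv θ A π' ⟨e, he.mem⟩) →
      γ.act hs u = sigmaCone (transMap (𝟙 _) u (conjEquiv θ A π' ⟨e, he.mem⟩)) := by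
    rintro _ hs rfl
    exact sigmaCone_act _ u hs
  exact (h3.trans (key _ _ h1)).trans (congrArg sigmaCone h5).symm

theorem IsDuality.eq_permDuality {χ : bifunctorLeft (gammaPerm θ) ≅ bifunctorRight (deltaPerm θ)}
    (h : IsDuality (gammaPerm θ) (deltaPerm θ) χ) : χ = permDuality θ := by
  apply Iso.ext
  apply NatTrans.ext
  funext ⟨A, π⟩
  ext x
  obtain ⟨a, rfl⟩ := gammaCone_app_surjective (partitionPerm θ) A π x
  exact coneRight_injective ((h.imageCone_eq a).trans (imageCone_permDuality θ a).symm)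

/-- Equality of functors `Δ` and `deltaPerm θ` on morphisms involves transport along equalities of
objects, which does not alter the underlying cones. -/
theorem NormalDual.eqToHom_app {C : Type u} [SmallCategory C] [NormalCategory C]
    {F G : NormalDual C} (h : F = G) (c : C) (x : F.sets c) :
    (NatTrans.app (F := F.toFunctor) (G := G.toFunctor) (eqToHom h) c x).1 = x.1 := by
  subst h
  rfl

theorem IsDuality.eq_deltaPerm (h : IsDuality (gammaPerm θ) Δ χ) : Δ = deltaPerm θ := by
  have hobj : ∀ A, Δ.obj A = (deltaPerm θ).obj A := by
    intro A
    refine NormalDual.ext (funext fun π => Set.Subset.antisymm ?_ ?_)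
    · intro γ hγ
      obtain ⟨a, rfl⟩ := exists_imageCone_eq χ hγ
      rw [h.imageCone_eq]
      exact ⟨_, rfl⟩
    · rintro _ ⟨b, rfl⟩
      obtain ⟨a, rfl⟩ := (conjEquiv θ A π).surjective b
      rw [← h.imageCone_eq]
      exact imageCone_mem χ a
  refine CategoryTheory.Functor.ext hobj fun A B f => ?_
  apply NatTrans.ext
  funext π
  ext x
  change (Δ.obj A).sets π at x
  obtain ⟨γ, hγ⟩ := x
  obtain ⟨a, rfl⟩ := exists_imageCone_eq χ hγ
  refine Subtype.ext ?_
  -- Naturality of `χ` in the first variable expresses `Δ(f)` on the cone of `a` through the cone of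
  -- `a f`, which is already known.
  have h1 := (imageCone_transMap χ f (𝟙 π) a).trans (coneRight_map_id Δ f π _)
  have h2 := conjEquiv_transMap θ f (𝟙 π) a
  refine h1.symm.trans ((h.imageCone_eq _).trans ?_)
  refine (congrArg sigmaCone h2).trans ?_
  refine Eq.trans ?_ (NormalDual.eqToHom_app (hobj B).symm π _).symm
  refine (deltaPerm_map_app θ f π _ (conjEquiv θ A π a) ?_).symm
  exact (NormalDual.eqToHom_app (hobj A) π _).trans (h.imageCone_eq a)

end

end CrossConn

theorem mainTheorem5 {X : Type u} [Nontrivial X] (θ : Equiv.Perm X) :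
    ∃ χ : gammaBifunctor (partitionPerm θ) ≅ deltaBifunctor (powersetPerm θ),
      (∀ (A : PowersetCat X) (π : PartitionCat X)
        (a : (gammaBifunctor (partitionPerm θ)).obj (A, π)),
        deltaTrans (χ.hom.app (A, π) a) = fun x => θ (gammaTrans a (θ.symm x))) ∧
      IsDuality (gammaPerm θ) (deltaPerm θ)
        ((gammaCone (partitionPerm θ)).symm ≪≫ χ ≪≫ deltaCone (powersetPerm θ)) ∧
      (∀ χ' : bifunctorLeft (gammaPerm θ) ≅ bifunctorRight (deltaPerm θ),
        IsDuality (gammaPerm θ) (deltaPerm θ) χ' →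
          χ' = (gammaCone (partitionPerm θ)).symm ≪≫ χ ≪≫ deltaCone (powersetPerm θ)) ∧
      (∀ (Δ : PowersetCat X ⥤ NormalDual (PartitionCat X))
        (χ' : bifunctorLeft (gammaPerm θ) ≅ bifunctorRight Δ),
        IsDuality (gammaPerm θ) Δ χ' → Δ = deltaPerm θ) :=
  ⟨conjIso θ, fun _ _ _ => rfl, isDuality_permDuality θ, fun _ h => h.eq_permDuality,
    fun _ _ h => h.eq_deltaPerm⟩
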